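/- Let $Q$ be a finite-dimensional, Hausdorff, paracompact real-analytic manifold (without boundary), $\nabla$ an analytic affine connection on $Q$ (torsion is allowed), and $\mathscr{Y}=\{Y_1,\dots,Y_r\}$ a finite family of analytic vector fields on $Q$. Let $\mathrm{Sym}^{(\infty)}(\mathscr{Y})$ be the smallest $\mathbb{R}$-subspace of vector fields on $Q$ that contains $\mathscr{Y}$ and is closed under the symmetric product $\langle X\colon Y\rangle=\nabla_XY+\nabla_YX$; write $\mathrm{Sym}^{(\infty)}(\mathscr{Y})_q=\{X(q) : X\in \mathrm{Sym}^{(\infty)}(\mathscr{Y})\}\subseteq T_qQ$, and regard this distribution also as the subset $\{v_q\in TQ : v_q\in \mathrm{Sym}^{(\infty)}(\mathscr{Y})_q\}$ of $TQ$. Let $Z$ be the geodesic spray of $\nabla$ on $TQ$ (in coordinates $Z=v^i\,\partial/\partial q^i-\Gamma^k_{ij}(q)v^iv^j\,\partial/\partial v^k$), let $Y_a^V$ be the vertical lift of $Y_a$, $Y_a^V(v_q)=\frac{d}{dt}\big|_{t=0}(v_q+tY_a(q))$, and let $\mathrm{Lie}^{(\infty)}(Z,\mathscr{Y}^V)$ be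 the smallest $\mathbb{R}$-subspace of vector fields on $TQ$ that contains $Z,Y_1^V,\dots,Y_r^V$ and is closed under the Lie bracket, with $\mathrm{Lie}^{(\infty)}(Z,\mathscr{Y}^V)_{v_q}\subseteq T_{v_q}TQ$ the subspace of its values at $v_q$. Let $v_q\in \mathrm{Sym}^{(\infty)}(\mathscr{Y})$ and suppose that the dimension of $\mathrm{Sym}^{(\infty)}(\mathscr{Y})_p$ is constant for $p$ in some neighbourhood of $q$, so that $\mathrm{Sym}^{(\infty)}(\mathscr{Y})$ is, over that neighbourhood, an analytic submanifold of $TQ$. Then \[\mathrm{Lie}^{(\infty)}(Z,\mathscr{Y}^V)_{v_q}\subseteq T_{v_q}\,\mathrm{Sym}^{(\infty)}(\mathscr{Y}).\] -/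

import Mathlib

open scoped Manifold ContDiff Topology

noncomputable section

namespace ACCS

variable {E : Type*} [NormedAddCommGroup E] [NormedSpace ℝ E]
  {Q : Type*} [TopologicalSpace Q] [ChartedSpace E Q]

/-- A vector field `X` on `Q` is analytic: the section `q ↦ (q, X q)` of `TQ` is of class `C^ω`. -/
def IsAnalyticVectorField [IsManifold 𝓘(ℝ, E) 1 Q] (X : (q : Q) → TangentSpace 𝓘(ℝ, E) q) : Prop :=
  ContMDiff 𝓘(ℝ, E) 𝓘(ℝ, E).tangent ω (fun q ↦ (⟨q, X q⟩ : TangentBundle 𝓘(ℝ, E) Q))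

/-- An affine connection on `Q`: a covariant derivative on `TQ`. In Mathlib's argument order
`nabla Y q (X q)` is the value of `∇_X Y` at `q`. -/
abbrev AffineConnection (E : Type*) [NormedAddCommGroup E] [NormedSpace ℝ E]
    (Q : Type*) [TopologicalSpace Q] [ChartedSpace E Q] [IsManifold 𝓘(ℝ, E) 1 Q] :=
  CovariantDerivative 𝓘(ℝ, E) E (TangentSpace 𝓘(ℝ, E) : Q → Type _)

/-- The connection is analytic: over every open set it sends analytic vector fields to analytic
ones (equivalently, its Christoffel symbols are analytic in every analytic chart). -/
def IsAnalyticConnection [IsManifold 𝓘(ℝ, E) 1 Q] (nabla : AffineConnection E Q) : Prop :=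
  ∀ u : Set Q, IsOpen u → ContMDiffCovariantDerivativeOn E ω nabla.toFun u

/-- The symmetric product `⟨X : Y⟩ = ∇_X Y + ∇_Y X`. -/
def symProd [IsManifold 𝓘(ℝ, E) 1 Q] (nabla : AffineConnection E Q)
    (X Y : (q : Q) → TangentSpace 𝓘(ℝ, E) q) : (q : Q) → TangentSpace 𝓘(ℝ, E) q :=
  fun q ↦ nabla Y q (X q) + nabla X q (Y q)

/-- The symmetric closure of a set `𝒴` of vector fields: the smallest real subspace of vector fields
that contains `𝒴` and is closed under the symmetric product. (If `nabla` and the members of `𝒴` are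
analytic, then so are all its members, since the analytic fields form such a subspace.) -/
def symClosure [IsManifold 𝓘(ℝ, E) 1 Q] (nabla : AffineConnection E Q)
    (𝒴 : Set ((q : Q) → TangentSpace 𝓘(ℝ, E) q)) :
    Submodule ℝ ((q : Q) → TangentSpace 𝓘(ℝ, E) q) :=
  sInf {S | 𝒴 ⊆ S ∧ ∀ X ∈ S, ∀ Y ∈ S, symProd nabla X Y ∈ S}

/-- The value at `q` of the symmetric closure, a subspace of `T_q Q`. -/
def symDistrib [IsManifold 𝓘(ℝ, E) 1 Q] (nabla : AffineConnection E Q)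
    (𝒴 : Set ((q : Q) → TangentSpace 𝓘(ℝ, E) q)) (q : Q) :
    Submodule ℝ (TangentSpace 𝓘(ℝ, E) q) :=
  (symClosure nabla 𝒴).map (LinearMap.proj q)

/-- A family of subspaces of the tangent spaces, regarded as a subset of `TQ`. -/
def distribTotal (D : (q : Q) → Submodule ℝ (TangentSpace 𝓘(ℝ, E) q)) :
    Set (TangentBundle 𝓘(ℝ, E) Q) :=
  {v | v.2 ∈ D v.proj}

/-- The distribution `D` has constant rank on a neighbourhood of `q`. -/
def LocallyConstantRankAt (D : (q : Q) → Submodule ℝ (TangentSpace 𝓘(ℝ, E) q)) (q : Q) : Prop :=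
  ∀ᶠ p in 𝓝 q, Module.finrank ℝ (D p) = Module.finrank ℝ (D q)

/-- The vertical lift `T_q Q → T_{v}(TQ)` at `v = v_q`, sending `x` to `d/dt (v + t x)` at `t = 0`. -/
def vlft [IsManifold 𝓘(ℝ, E) 1 Q] (v : TangentBundle 𝓘(ℝ, E) Q)
    (x : TangentSpace 𝓘(ℝ, E) v.proj) : TangentSpace 𝓘(ℝ, E).tangent v :=
  mfderiv 𝓘(ℝ, ℝ) 𝓘(ℝ, E).tangent
    (fun t : ℝ ↦ (⟨v.proj, v.2 + t • x⟩ : TangentBundle 𝓘(ℝ, E) Q)) 0 (1 : ℝ)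

/-- The vertical lift `X^V` of a vector field `X`. -/
def verticalLift [IsManifold 𝓘(ℝ, E) 1 Q] (X : (q : Q) → TangentSpace 𝓘(ℝ, E) q) :
    (v : TangentBundle 𝓘(ℝ, E) Q) → TangentSpace 𝓘(ℝ, E).tangent v :=
  fun v ↦ vlft v (X v.proj)

/-- The horizontal lift `T_q Q → T_{v}(TQ)` at `v = v_q`, namely
`x ↦ T_q V (x) - vlft_v (∇_x V)` for any vector field `V` near `q` with `V q = v`; the value does not
depend on `V`, and here `V` is the field with constant components in the chart at `q`.
(In coordinates: `x^i ∂/∂q^i - Γ^k_{ij} x^i v^j ∂/∂v^k`.) -/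
def hlft [IsManifold 𝓘(ℝ, E) 1 Q] (nabla : AffineConnection E Q) (v : TangentBundle 𝓘(ℝ, E) Q)
    (x : TangentSpace 𝓘(ℝ, E) v.proj) : TangentSpace 𝓘(ℝ, E).tangent v :=
  let V : (q : Q) → TangentSpace 𝓘(ℝ, E) q := FiberBundle.extend E v.2
  let TV : TangentSpace 𝓘(ℝ, E).tangent v :=
    mfderiv 𝓘(ℝ, E) 𝓘(ℝ, E).tangent
      (fun q ↦ (⟨q, V q⟩ : TangentBundle 𝓘(ℝ, E) Q)) v.proj x
  TV - vlft v (nabla V v.proj x)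

/-- The geodesic spray: the vector field on `TQ` whose value at `v` is the horizontal lift of `v` at
`v`. (In coordinates: `v^i ∂/∂q^i - Γ^k_{ij} v^i v^j ∂/∂v^k`.) -/
def geodesicSpray [IsManifold 𝓘(ℝ, E) 1 Q] (nabla : AffineConnection E Q) :
    (v : TangentBundle 𝓘(ℝ, E) Q) → TangentSpace 𝓘(ℝ, E).tangent v :=
  fun v ↦ hlft nabla v v.2

/-- The involutive closure of a set `𝒱` of vector fields on `TQ`: the smallest real subspace of
vector fields that contains `𝒱` and is closed under the Lie bracket. (If `Q` and the members of `𝒱`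
are analytic, then so are all its members.) -/
def lieClosure [IsManifold 𝓘(ℝ, E) 1 Q]
    (𝒱 : Set ((v : TangentBundle 𝓘(ℝ, E) Q) → TangentSpace 𝓘(ℝ, E).tangent v)) :
    Submodule ℝ ((v : TangentBundle 𝓘(ℝ, E) Q) → TangentSpace 𝓘(ℝ, E).tangent v) :=
  sInf {S | 𝒱 ⊆ S ∧ ∀ X ∈ S, ∀ Y ∈ S, VectorField.mlieBracket 𝓘(ℝ, E).tangent X Y ∈ S}

/-- The accessibility distribution `Lie^(∞)(Z, 𝒴^V)` at `v`. -/
def accessDistrib [IsManifold 𝓘(ℝ, E) 1 Q] (nabla : AffineConnection E Q)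
    (𝒴 : Set ((q : Q) → TangentSpace 𝓘(ℝ, E) q)) (v : TangentBundle 𝓘(ℝ, E) Q) :
    Submodule ℝ (TangentSpace 𝓘(ℝ, E).tangent v) :=
  (lieClosure (insert (geodesicSpray nabla) (verticalLift '' 𝒴))).map (LinearMap.proj v)

/-- The tangent space at `v` of an analytic submanifold `S` of `TQ`: the set of velocities at time
`0` of analytic curves that lie in `S` and pass through `v` at time `0`. -/
def tangentSet [IsManifold 𝓘(ℝ, E) 1 Q] (S : Set (TangentBundle 𝓘(ℝ, E) Q))
    (v : TangentBundle 𝓘(ℝ, E) Q) : Set (TangentSpace 𝓘(ℝ, E).tangent v) :=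
  {w | ∃ c : ℝ → TangentBundle 𝓘(ℝ, E) Q,
    ContMDiffAt 𝓘(ℝ, ℝ) 𝓘(ℝ, E).tangent ω c 0 ∧ (∀ᶠ t in 𝓝 (0 : ℝ), c t ∈ S) ∧
    (⟨c 0, mfderiv 𝓘(ℝ, ℝ) 𝓘(ℝ, E).tangent c 0 (1 : ℝ)⟩ :
      TangentBundle 𝓘(ℝ, E).tangent (TangentBundle 𝓘(ℝ, E) Q)) = ⟨v, w⟩}

end ACCS

end

/-! Vector fields tangent to a submanifold form a real vector space closed under the Lie bracket, so
it suffices that the generators `Z` and `Y_a^V` are tangent to the distribution `D = Sym^(∞)(𝒴)`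
wherever its rank is locally constant.

For `Y_a^V` this is clear: the line `t ↦ v + t Y_a(q)` stays in the fibre `D_q`. For `Z` at `v ∈
D_q`, choose `X` in the symmetric closure with `X(q) = v`. Then `Z(v) = TX(X(q)) - vlft_v((∇_X
X)(q))` (`geodesicSpray_eq`). The first term is tangent because `X` is a section of `D`, the second
because `∇_X X = ½⟨X : X⟩` takes values in `D`.

Tangent vectors are velocities of analytic curves, a set not visibly closed under addition.
Linearity and the bracket argument come from a local defining map `F` of `D`, built from an analytic
frame (`exists_defining_map`): the tangent set is `ker dF` (`mem_velocitySet_iff`). Bracket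
stability is then symmetry of the second derivative of `F` (`fderiv_lieBracket_eq_zero`). Chart
formulas for the lifts give smoothness of the generators and the formula for `Z`. -/

noncomputable section

namespace ACCS

/-! ### Calculus in a vector space: brackets and defining maps. -/

section VectorSpace

variable {E : Type*} [NormedAddCommGroup E] [NormedSpace ℝ E]

theorem fderiv_apply_eq_zero_of_curve {G : Type*} [NormedAddCommGroup G] [NormedSpace ℝ G]
    {F : E → G} {z w : E} {c : ℝ → E} (hF : DifferentiableAt ℝ F z) (hc0 : c 0 = z)
    (hc : HasDerivAt c w 0) (hcF : ∀ᶠ t in 𝓝 (0 : ℝ), F (c t) = 0) : fderiv ℝ F z w = 0 := by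
  subst hc0
  have h1 : HasDerivAt (F ∘ c) (fderiv ℝ F (c 0) w) 0 := hF.hasFDerivAt.comp_hasDerivAt 0 hc
  have h2 : HasDerivAt (F ∘ c) 0 0 :=
    (hasDerivAt_const (0 : ℝ) (0 : G)).congr_of_eventuallyEq hcF
  exact h1.unique h2

/-- The identity `dF(U) = 0` holds only on `D`, so it can be differentiated only along curves in
`D`. Along one with velocity `w` it gives `dF(DU w) + D²F(w, U) = 0`. Taking `(U, w) = (W, V z)` and
`(V, W z)` and subtracting, the second-order terms cancel by symmetry. -/
theorem fderiv_lieBracket_eq_zero {G : Type*} [NormedAddCommGroup G] [NormedSpace ℝ G]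
    {F : E → G} {V W : E → E} {z : E} {D : Set E} {c d : ℝ → E}
    (hF : ContDiffAt ℝ 2 F z) (hV : DifferentiableAt ℝ V z) (hW : DifferentiableAt ℝ W z)
    (hFV : ∀ᶠ y in 𝓝 z, y ∈ D → fderiv ℝ F y (V y) = 0)
    (hFW : ∀ᶠ y in 𝓝 z, y ∈ D → fderiv ℝ F y (W y) = 0)
    (hc0 : c 0 = z) (hc : HasDerivAt c (V z) 0) (hcD : ∀ᶠ t in 𝓝 (0 : ℝ), c t ∈ D)
    (hd0 : d 0 = z) (hd : HasDerivAt d (W z) 0) (hdD : ∀ᶠ t in 𝓝 (0 : ℝ), d t ∈ D) :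
    fderiv ℝ F z (VectorField.lieBracket ℝ V W z) = 0 := by
  have hF' : DifferentiableAt ℝ (fderiv ℝ F) z :=
    (hF.fderiv_right (m := 1) (by norm_num)).differentiableAt one_ne_zero
  have key : ∀ (U : E → E) (w : E) (γ : ℝ → E), DifferentiableAt ℝ U z →
      (∀ᶠ y in 𝓝 z, y ∈ D → fderiv ℝ F y (U y) = 0) → γ 0 = z → HasDerivAt γ w 0 →
      (∀ᶠ t in 𝓝 (0 : ℝ), γ t ∈ D) →
      fderiv ℝ F z (fderiv ℝ U z w) + fderiv ℝ (fderiv ℝ F) z w (U z) = 0 := by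
    intro U w γ hU hFU h0 hγ hD
    have h1 : HasFDerivAt (fun y ↦ fderiv ℝ F y (U y)) _ z :=
      hF'.hasFDerivAt.clm_apply hU.hasFDerivAt
    have h2 := fderiv_apply_eq_zero_of_curve h1.differentiableAt h0 hγ (by
      have : Filter.Tendsto γ (𝓝 0) (𝓝 z) := h0 ▸ hγ.continuousAt
      filter_upwards [hD, this.eventually hFU] with t h3 h4 using h4 h3)
    rw [h1.fderiv] at h2
    simpa using h2
  have e1 := key W (V z) c hW hFW hc0 hc hcD
  have e2 := key V (W z) d hV hFV hd0 hd hdD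
  have hs : fderiv ℝ (fderiv ℝ F) z (V z) (W z) = fderiv ℝ (fderiv ℝ F) z (W z) (V z) :=
    (hF.isSymmSndFDerivAt (by simp)).eq _ _
  rw [VectorField.lieBracket, map_sub, sub_eq_zero]
  rw [hs] at e1
  exact add_right_cancel (e1.trans e2.symm)

/-- A locally free analytic family of subspaces is, near the given point, the zero set of an analytic
map whose differential has the velocities of analytic curves in the family as its kernel. -/
theorem exists_defining_map [FiniteDimensional ℝ E] {ι : Type*} [Fintype ι] {X : ι → E → E} {x₀ : E}
    (hX : ∀ i, ContDiffAt ℝ ω (X i) x₀) (hli : LinearIndependent ℝ (fun i ↦ X i x₀)) :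
    (∀ᶠ x in 𝓝 x₀, LinearIndependent ℝ (fun i ↦ X i x)) ∧
    ∃ F : E × E → E, (∀ a, ContDiffAt ℝ ω F (x₀, a)) ∧
      (∀ᶠ x in 𝓝 x₀, ∀ a, F (x, a) = 0 ↔ a ∈ Submodule.span ℝ (Set.range fun i ↦ X i x)) ∧
      ∀ a ∈ Submodule.span ℝ (Set.range fun i ↦ X i x₀), ∀ w, fderiv ℝ F (x₀, a) w = 0 →
        ∃ c : ℝ → E × E, ContDiffAt ℝ ω c 0 ∧ c 0 = (x₀, a) ∧ HasDerivAt c w 0 ∧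
          ∀ᶠ t in 𝓝 (0 : ℝ), F (c t) = 0 := by
  have : CompleteSpace E := FiniteDimensional.complete ℝ E
  obtain ⟨s, s_apply, hs⟩ : ∃ s : E → (ι → ℝ) →L[ℝ] E,
      (∀ x b, s x b = ∑ i, b i • X i x) ∧ ContDiffAt ℝ ω s x₀ := by
    refine ⟨fun x ↦ ∑ i, (ContinuousLinearMap.proj (R := ℝ) (φ := fun _ : ι ↦ ℝ) i).smulRight
      (X i x), fun x b ↦ by simp, ContDiffAt.sum fun i _ ↦ ?_⟩
    exact ((ContinuousLinearMap.smulRightL ℝ (ι → ℝ) E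
      (ContinuousLinearMap.proj (R := ℝ) (φ := fun _ : ι ↦ ℝ) i)).contDiff.contDiffAt).comp x₀ (hX i)
  have mem_span : ∀ x a, a ∈ Submodule.span ℝ (Set.range fun i ↦ X i x) ↔ ∃ b, s x b = a := by
    intro x a
    rw [Submodule.mem_span_range_iff_exists_fun]
    simp [s_apply]
  have hker : LinearMap.ker (s x₀).toLinearMap = ⊥ := by
    rw [LinearMap.ker_eq_bot']
    intro b hb
    funext i
    exact Fintype.linearIndependent_iff.1 hli b (by simpa [s_apply] using hb) i
  obtain ⟨g', hg'⟩ := (s x₀).toLinearMap.exists_leftInverse_of_injective hker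
  let g : E →L[ℝ] (ι → ℝ) := LinearMap.toContinuousLinearMap g'
  have hg : ∀ b, g (s x₀ b) = b := fun b ↦ LinearMap.congr_fun hg' b
  -- `A x` straightens the family: it carries the span at `x₀` onto the span at `x`, and is
  -- invertible near `x₀` because `A x₀ = id`.
  let A : E → E →L[ℝ] E := fun x ↦ ContinuousLinearMap.id ℝ E + (s x - s x₀) ∘L g
  have hA : ContDiffAt ℝ ω A x₀ :=
    contDiffAt_const.add ((hs.sub contDiffAt_const).clm_comp contDiffAt_const)
  have hA0 : A x₀ = ContinuousLinearMap.id ℝ E := by simp [A]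
  have hAs : ∀ x b, A x (s x₀ b) = s x b := by intro x b; simp [A, hg]
  have hunit : ∀ᶠ x in 𝓝 x₀, IsUnit (A x) := by
    refine hA.continuousAt.eventually (Units.isOpen.mem_nhds ?_)
    rw [hA0]; exact isUnit_one
  -- Projection whose kernel is the span at `x₀`; composing it with `(A x)⁻¹` cuts out the span at
  -- `x`.
  let P : E →L[ℝ] E := ContinuousLinearMap.id ℝ E - s x₀ ∘L g
  have hP : ∀ u, P u = 0 ↔ ∃ b, s x₀ b = u := by
    intro u
    constructor
    · intro h
      exact ⟨g u, (sub_eq_zero.1 (by simpa [P] using h)).symm⟩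
    · rintro ⟨b, rfl⟩
      simp [P, hg]
  let B : E → E →L[ℝ] E := fun x ↦ Ring.inverse (A x)
  have hB0 : B x₀ = ContinuousLinearMap.id ℝ E := by
    simp only [B, hA0]; exact Ring.inverse_one _
  have hB : ContDiffAt ℝ ω B x₀ := by
    have h1 : ContDiffAt ℝ ω Ring.inverse (A x₀) := by
      rw [hA0]; exact contDiffAt_ringInverse ℝ (1 : (E →L[ℝ] E)ˣ)
    exact h1.comp x₀ hA
  let F : E × E → E := fun z ↦ P (B z.1 z.2)
  have hF : ∀ a, ContDiffAt ℝ ω F (x₀, a) := by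
    intro a
    refine P.contDiff.contDiffAt.comp _ (ContDiffAt.clm_apply ?_ contDiffAt_snd)
    exact ContDiffAt.comp (x₀, a) (f := Prod.fst) (g := B) hB contDiffAt_fst
  have hBA : ∀ᶠ x in 𝓝 x₀, (∀ a, B x (A x a) = a) ∧ ∀ a, A x (B x a) = a := by
    filter_upwards [hunit] with x hx
    exact ⟨fun a ↦ congrArg (fun T : E →L[ℝ] E ↦ T a) (Ring.inverse_mul_cancel _ hx),
      fun a ↦ congrArg (fun T : E →L[ℝ] E ↦ T a) (Ring.mul_inverse_cancel _ hx)⟩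
  have hFs : ∀ᶠ x in 𝓝 x₀, ∀ a, F (x, a) = 0 ↔ ∃ b, s x b = a := by
    filter_upwards [hBA] with x hx a
    simp only [F]
    rw [hP]
    refine exists_congr fun b ↦ ?_
    constructor
    · intro h; rw [← hAs, h, hx.2]
    · rintro rfl; rw [← hAs x, hx.1]
  refine ⟨?_, F, hF, ?_, ?_⟩
  · filter_upwards [hBA] with x hx
    rw [Fintype.linearIndependent_iff]
    intro b hb
    rw [← s_apply, ← hAs] at hb
    have h0 : s x₀ b = 0 := by rw [← hx.1 (s x₀ b), hb, map_zero]
    exact Fintype.linearIndependent_iff.1 hli b (by rw [← s_apply, h0])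
  · filter_upwards [hFs] with x hx a
    rw [hx, mem_span]
  · intro a ha w hw
    obtain ⟨b, rfl⟩ := (mem_span _ _).1 ha
    -- Move the base point along `w.1` and the frame coefficients along `β`. It remains to find `β`
    -- giving the prescribed second component `w.2`.
    have curve : ∀ β : ι → ℝ, ∃ c : ℝ → E × E, ContDiffAt ℝ ω c 0 ∧ c 0 = (x₀, s x₀ b) ∧
        HasDerivAt c (w.1, fderiv ℝ s x₀ w.1 b + s x₀ β) 0 ∧ ∀ᶠ t in 𝓝 (0 : ℝ), F (c t) = 0 := by
      intro β
      have hl : HasDerivAt (fun t : ℝ ↦ x₀ + t • w.1) w.1 0 := by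
        simpa using ((hasDerivAt_id (0 : ℝ)).smul_const w.1).const_add x₀
      have hb : HasDerivAt (fun t : ℝ ↦ b + t • β) β 0 := by
        simpa using ((hasDerivAt_id (0 : ℝ)).smul_const β).const_add b
      have hlc : ContDiff ℝ ω (fun t : ℝ ↦ x₀ + t • w.1) := by fun_prop
      have hbc : ContDiff ℝ ω (fun t : ℝ ↦ b + t • β) := by fun_prop
      have hs' : ContDiffAt ℝ ω s (x₀ + (0 : ℝ) • w.1) := by simpa using hs
      refine ⟨fun t ↦ (x₀ + t • w.1, s (x₀ + t • w.1) (b + t • β)), ?_, by simp, ?_, ?_⟩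
      · refine hlc.contDiffAt.prodMk (ContDiffAt.clm_apply ?_ hbc.contDiffAt)
        exact hs'.comp (0 : ℝ) hlc.contDiffAt
      · refine hl.prodMk ?_
        have h1 : HasDerivAt (fun t : ℝ ↦ s (x₀ + t • w.1))
            (fderiv ℝ s (x₀ + (0 : ℝ) • w.1) w.1) 0 :=
          (hs'.differentiableAt (by simp)).hasFDerivAt.comp_hasDerivAt 0 hl
        simpa using h1.clm_apply hb
      · have : Filter.Tendsto (fun t : ℝ ↦ x₀ + t • w.1) (𝓝 0) (𝓝 x₀) := by
          simpa using hl.continuousAt.tendsto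
        filter_upwards [this.eventually hFs] with t ht
        exact (ht _).2 ⟨_, rfl⟩
    -- Subtracting the velocity for `β = 0` leaves a vertical vector in `ker dF`. On the fibre over
    -- `x₀` the map `F` is `P`, so this vector lies in the span at `x₀` and its coefficients are the
    -- required `β`.
    obtain ⟨c₀, -, hc₀, hc₀', hc₀F⟩ := curve 0
    have h0 := fderiv_apply_eq_zero_of_curve ((hF _).differentiableAt (by simp)) hc₀ hc₀' hc₀F
    have h1 : fderiv ℝ F (x₀, s x₀ b) (0, w.2 - fderiv ℝ s x₀ w.1 b) = 0 := by
      have := (fderiv ℝ F (x₀, s x₀ b)).map_sub w (w.1, fderiv ℝ s x₀ w.1 b + s x₀ 0)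
      rw [hw, h0, sub_zero] at this
      refine Eq.trans (congrArg (fderiv ℝ F (x₀, s x₀ b)) (Prod.ext ?_ ?_)) this <;> simp
    have h2 : fderiv ℝ F (x₀, s x₀ b) (0, w.2 - fderiv ℝ s x₀ w.1 b)
        = P (w.2 - fderiv ℝ s x₀ w.1 b) := by
      set u := w.2 - fderiv ℝ s x₀ w.1 b
      have hγ : HasDerivAt (fun t : ℝ ↦ (x₀, s x₀ b + t • u)) ((0 : E), u) 0 :=
        (hasDerivAt_const (0 : ℝ) x₀).prodMk
          (by simpa using ((hasDerivAt_id (0 : ℝ)).smul_const u).const_add (s x₀ b))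
      have hF' : HasFDerivAt F (fderiv ℝ F (x₀, s x₀ b)) (x₀, s x₀ b + (0 : ℝ) • u) := by
        simpa using ((hF (s x₀ b)).differentiableAt (by simp)).hasFDerivAt
      have e1 := hF'.comp_hasDerivAt (0 : ℝ) hγ
      have e2 : HasDerivAt (F ∘ fun t : ℝ ↦ (x₀, s x₀ b + t • u)) (P u) 0 := by
        have : (F ∘ fun t : ℝ ↦ (x₀, s x₀ b + t • u)) = fun t ↦ P (s x₀ b) + t • P u := by
          funext t; simp [F, hB0]
        rw [this]
        simpa using ((hasDerivAt_id (0 : ℝ)).smul_const (P u)).const_add (P (s x₀ b))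
      exact e1.unique e2
    obtain ⟨β, hβ⟩ := (hP _).1 (h2.symm.trans h1)
    obtain ⟨c, h3, h4, h5, h6⟩ := curve β
    refine ⟨c, h3, h4, ?_, h6⟩
    convert h5 using 1
    rw [hβ]
    ext <;> simp

end VectorSpace

/-! ### Velocity sets on manifolds and tangency to a zero set. -/

section Submanifold

variable {E : Type*} [NormedAddCommGroup E] [NormedSpace ℝ E] {H : Type*} [TopologicalSpace H]
  {I : ModelWithCorners ℝ E H} {M : Type*} [TopologicalSpace M] [ChartedSpace H M]
  {G : Type*} [NormedAddCommGroup G] [NormedSpace ℝ G]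

/-- The velocities at time `0` of analytic curves in `S` that pass through `v` at time `0`. -/
def velocitySet (I : ModelWithCorners ℝ E H) (S : Set M) (v : M) : Set (TangentSpace I v) :=
  {w | ∃ c : ℝ → M, ContMDiffAt 𝓘(ℝ, ℝ) I ω c 0 ∧ (∀ᶠ t in 𝓝 (0 : ℝ), c t ∈ S) ∧
    (⟨c 0, mfderiv 𝓘(ℝ, ℝ) I c 0 (1 : ℝ)⟩ : TangentBundle I M) = ⟨v, w⟩}

theorem exists_curve_of_mem_velocitySet [IsManifold I 1 M] {S : Set M} {v z : M}
    (hz : z ∈ (extChartAt I v).source) {w : TangentSpace I z} (hw : w ∈ velocitySet I S z) :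
    ∃ c : ℝ → E, c 0 = extChartAt I v z ∧
      HasDerivAt c (mfderiv I 𝓘(ℝ, E) (extChartAt I v) z w : E) 0 ∧
      ∀ᶠ t in 𝓝 (0 : ℝ), (extChartAt I v).symm (c t) ∈ S := by
  obtain ⟨c, hc, hcS, h⟩ := hw
  obtain rfl : c 0 = z := congrArg Bundle.TotalSpace.proj h
  have hw : mfderiv 𝓘(ℝ, ℝ) I c 0 (1 : ℝ) = w := by
    simpa using h
  have hcd : MDifferentiableAt 𝓘(ℝ, ℝ) I c 0 := hc.mdifferentiableAt (by simp)
  have hψ : MDifferentiableAt I 𝓘(ℝ, E) (extChartAt I v) (c 0) :=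
    mdifferentiableAt_extChartAt (by rwa [extChartAt_source] at hz)
  refine ⟨extChartAt I v ∘ c, rfl, ?_, ?_⟩
  · let L : ℝ →L[ℝ] E := (mfderiv I 𝓘(ℝ, E) (extChartAt I v) (c 0)).comp (mfderiv 𝓘(ℝ, ℝ) I c 0)
    have h1 : HasFDerivAt (extChartAt I v ∘ c) L 0 :=
      (hψ.hasMFDerivAt.comp (0 : ℝ) hcd.hasMFDerivAt).hasFDerivAt
    rw [← hw]
    exact h1.hasDerivAt
  · filter_upwards [hcS, hc.continuousAt.eventually
      ((isOpen_extChartAt_source v).mem_nhds hz)] with t h1 h2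
    rw [Function.comp_apply, (extChartAt I v).left_inv h2]
    exact h1

/-- All tangent spaces are the model space `E` by definition, so vectors over propositionally equal
points can be compared there. -/
theorem tangentBundle_mk_eq {x y : M} (h : x = y) {u : TangentSpace I x} {w : TangentSpace I y}
    (huw : (u : E) = (w : E)) : (⟨x, u⟩ : TangentBundle I M) = ⟨y, w⟩ := by
  subst h
  exact congrArg (fun z : TangentSpace I x ↦ (⟨x, z⟩ : TangentBundle I M)) huw

theorem mfderiv_extChartAt_symm_apply [IsManifold I 1 M] [I.Boundaryless] {v : M} {y : E}
    (hy : y = extChartAt I v v) (w : E) :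
    (mfderiv 𝓘(ℝ, E) I (extChartAt I v).symm y w : E) = w := by
  subst hy
  have h := mfderivWithin_range_extChartAt_symm (I := I) (x := v)
  rw [I.range_eq_univ, mfderivWithin_univ] at h
  rw [h]
  rfl

theorem mem_velocitySet_of_curve [IsManifold I ω M] [I.Boundaryless] {S : Set M} {v : M} {c : ℝ → E}
    {w : TangentSpace I v}
    (hc : ContDiffAt ℝ ω c 0) (hc0 : c 0 = extChartAt I v v) (hcw : HasDerivAt c (w : E) 0)
    (hcS : ∀ᶠ t in 𝓝 (0 : ℝ), (extChartAt I v).symm (c t) ∈ S) : w ∈ velocitySet I S v := by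
  have : IsManifold I 1 M := .of_le (n := ω) le_top
  have hs : ContMDiffAt 𝓘(ℝ, E) I ω (extChartAt I v).symm (c 0) := by
    rw [hc0]
    exact (contMDiffOn_extChartAt_symm v).contMDiffAt (extChartAt_target_mem_nhds v)
  have hγ : ContMDiffAt 𝓘(ℝ, ℝ) I ω ((extChartAt I v).symm ∘ c) 0 := hs.comp 0 hc.contMDiffAt
  have h0 : ((extChartAt I v).symm ∘ c) 0 = v := by simp [hc0]
  refine ⟨(extChartAt I v).symm ∘ c, hγ, hcS, ?_⟩
  have h1 : HasMFDerivAt 𝓘(ℝ, ℝ) I ((extChartAt I v).symm ∘ c) 0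
      ((mfderiv 𝓘(ℝ, E) I (extChartAt I v).symm (c 0)).comp
        (ContinuousLinearMap.toSpanSingleton ℝ (w : E))) :=
    HasMFDerivAt.comp (0 : ℝ) (hs.mdifferentiableAt (by simp)).hasMFDerivAt
      hcw.hasFDerivAt.hasMFDerivAt
  refine tangentBundle_mk_eq h0 ?_
  rw [h1.mfderiv]
  refine (mfderiv_extChartAt_symm_apply hc0 _).trans ?_
  exact one_smul ℝ (w : E)

/-- `S` is near `v`, in the chart at `v`, the zero set of an analytic map whose differential at `v`
has the velocities of analytic curves in `S` as its kernel. -/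
def IsZeroSetAt (I : ModelWithCorners ℝ E H) (G : Type*) [NormedAddCommGroup G] [NormedSpace ℝ G]
    (S : Set M) (v : M) (F : E → G) : Prop :=
  ContDiffAt ℝ ω F (extChartAt I v v) ∧
    (∀ᶠ y in 𝓝 (extChartAt I v v), (extChartAt I v).symm y ∈ S ↔ F y = 0) ∧
    ∀ w, fderiv ℝ F (extChartAt I v v) w = 0 → ∃ c : ℝ → E, ContDiffAt ℝ ω c 0 ∧
      c 0 = extChartAt I v v ∧ HasDerivAt c w 0 ∧ ∀ᶠ t in 𝓝 (0 : ℝ), F (c t) = 0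

namespace IsZeroSetAt

variable {S : Set M} {v : M} {F : E → G}

/-- At points near `v` only this inclusion in `ker dF` is available, since `IsZeroSetAt` supplies
curves at `v` alone; the bracket argument needs no more. -/
theorem eventually_fderiv_eq_zero [IsManifold I 1 M] [I.Boundaryless] (h : IsZeroSetAt I G S v F) :
    ∀ᶠ y in 𝓝 (extChartAt I v v), ∀ w ∈ velocitySet I S ((extChartAt I v).symm y),
      fderiv ℝ F y (mfderiv I 𝓘(ℝ, E) (extChartAt I v) ((extChartAt I v).symm y) w : E) = 0 := by
  have hd : ∀ᶠ y in 𝓝 (extChartAt I v v), DifferentiableAt ℝ F y :=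
    ((h.1.of_le (m := 1) (by simp)).eventually (by simp)).mono
      fun y hy ↦ hy.differentiableAt one_ne_zero
  filter_upwards [hd, h.2.1.eventually_nhds, extChartAt_target_mem_nhds (I := I) v]
    with y hFy hSy hy w hw
  obtain ⟨c, hc0, hc, hcS⟩ := exists_curve_of_mem_velocitySet ((extChartAt I v).map_target hy) hw
  rw [(extChartAt I v).right_inv hy] at hc0
  refine fderiv_apply_eq_zero_of_curve hFy hc0 hc ?_
  have : Filter.Tendsto c (𝓝 0) (𝓝 y) := hc0 ▸ hc.continuousAt
  filter_upwards [hcS, this.eventually hSy] with t h1 h2 using h2.1 h1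

theorem mem_velocitySet_iff [IsManifold I ω M] [I.Boundaryless] (h : IsZeroSetAt I G S v F)
    (w : TangentSpace I v) :
    w ∈ velocitySet I S v ↔ fderiv ℝ F (extChartAt I v v) (w : E) = 0 := by
  have : IsManifold I 1 M := .of_le (n := ω) le_top
  constructor
  · intro hw
    obtain ⟨c, hc0, hc, hcS⟩ := exists_curve_of_mem_velocitySet (mem_extChartAt_source v) hw
    rw [mfderiv_extChartAt_self] at hc
    refine fderiv_apply_eq_zero_of_curve (h.1.differentiableAt (by simp)) hc0 hc ?_
    have : Filter.Tendsto c (𝓝 0) (𝓝 (extChartAt I v v)) := hc0 ▸ hc.continuousAt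
    filter_upwards [hcS, this.eventually h.2.1] with t h1 h2 using h2.1 h1
  · intro hw
    obtain ⟨c, hca, hc0, hc, hcF⟩ := h.2.2 w hw
    refine mem_velocitySet_of_curve hca hc0 hc ?_
    have : Filter.Tendsto c (𝓝 0) (𝓝 (extChartAt I v v)) := hc0 ▸ hc.continuousAt
    filter_upwards [hcF, this.eventually h.2.1] with t h1 h2 using h2.2 h1

/-- `F` vanishes along `f`, so the chain rule puts the image of `df` in `ker dF`. Hence `f` need
only be differentiable, although velocities are defined by analytic curves. -/
theorem mfderiv_mem_velocitySet [IsManifold I ω M] [I.Boundaryless]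
    {E' : Type*} [NormedAddCommGroup E'] [NormedSpace ℝ E'] {H' : Type*} [TopologicalSpace H']
    {I' : ModelWithCorners ℝ E' H'} {N : Type*} [TopologicalSpace N] [ChartedSpace H' N]
    {f : N → M} {x : N} (h : IsZeroSetAt I G S (f x) F) (hf : MDifferentiableAt I' I f x)
    (hfS : ∀ᶠ y in 𝓝 x, f y ∈ S) (w : TangentSpace I' x) :
    mfderiv I' I f x w ∈ velocitySet I S (f x) := by
  have : IsManifold I 1 M := .of_le (n := ω) le_top
  rw [h.mem_velocitySet_iff]
  have hF : MDifferentiableAt 𝓘(ℝ, E) 𝓘(ℝ, G) F (extChartAt I (f x) (f x)) :=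
    (h.1.differentiableAt (by simp)).mdifferentiableAt
  have hψ : MDifferentiableAt I 𝓘(ℝ, E) (extChartAt I (f x)) (f x) :=
    mdifferentiableAt_extChartAt (mem_chart_source H (f x))
  have hψf := (hψ.hasMFDerivAt.comp x hf.hasMFDerivAt)
  have h1 := HasMFDerivAt.comp x (hF.hasMFDerivAt) hψf
  have h2 : HasMFDerivAt I' 𝓘(ℝ, G) (F ∘ extChartAt I (f x) ∘ f) x 0 := by
    refine (hasMFDerivAt_const (0 : G) x).congr_of_eventuallyEq ?_
    filter_upwards [hfS, (continuousAt_extChartAt (I := I) (f x)).tendsto.comp hf.continuousAt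
      |>.eventually h.2.1, hf.continuousAt.eventually (extChartAt_source_mem_nhds (I := I) (f x))]
      with y h3 h4 h5
    refine h4.1 ?_
    rw [Function.comp_apply, (extChartAt I (f x)).left_inv h5]
    exact h3
  have h3 := hasMFDerivAt_unique h1 h2
  rw [mfderiv_extChartAt_self, mfderiv_eq_fderiv] at h3
  exact congrArg (fun T ↦ T w) h3

theorem add_mem_velocitySet [IsManifold I ω M] [I.Boundaryless] (h : IsZeroSetAt I G S v F)
    {u w : TangentSpace I v} (hu : u ∈ velocitySet I S v) (hw : w ∈ velocitySet I S v) :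
    u + w ∈ velocitySet I S v := by
  rw [h.mem_velocitySet_iff] at *
  exact ((fderiv ℝ F (extChartAt I v v)).map_add u w).trans (by rw [hu, hw, add_zero])

theorem smul_mem_velocitySet [IsManifold I ω M] [I.Boundaryless] (h : IsZeroSetAt I G S v F)
    (a : ℝ) {w : TangentSpace I v} (hw : w ∈ velocitySet I S v) :
    a • w ∈ velocitySet I S v := by
  rw [h.mem_velocitySet_iff] at *
  exact ((fderiv ℝ F (extChartAt I v v)).map_smul a w).trans (by rw [hw, smul_zero])

theorem zero_mem_velocitySet [IsManifold I ω M] [I.Boundaryless] (h : IsZeroSetAt I G S v F) :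
    0 ∈ velocitySet I S v := by
  rw [h.mem_velocitySet_iff]
  exact (fderiv ℝ F (extChartAt I v v)).map_zero

theorem mlieBracket_mem_velocitySet [CompleteSpace E] [IsManifold I ω M] [I.Boundaryless]
    (h : IsZeroSetAt I G S v F)
    {V W : (x : M) → TangentSpace I x}
    (hV : MDifferentiableAt I I.tangent (fun x ↦ (⟨x, V x⟩ : TangentBundle I M)) v)
    (hW : MDifferentiableAt I I.tangent (fun x ↦ (⟨x, W x⟩ : TangentBundle I M)) v)
    (hv : v ∈ S) (hVS : ∀ᶠ z in 𝓝 v, z ∈ S → V z ∈ velocitySet I S z)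
    (hWS : ∀ᶠ z in 𝓝 v, z ∈ S → W z ∈ velocitySet I S z) :
    VectorField.mlieBracket I V W v ∈ velocitySet I S v := by
  have : IsManifold I 1 M := .of_le (n := ω) le_top
  have : IsManifold I 2 M := .of_le (n := ω) le_top
  set ψ := extChartAt I v with hψ
  have key : ∀ U : (x : M) → TangentSpace I x,
      MDifferentiableAt I I.tangent (fun x ↦ (⟨x, U x⟩ : TangentBundle I M)) v →
      (∀ᶠ z in 𝓝 v, z ∈ S → U z ∈ velocitySet I S z) →
      ∃ U' : E → E, U' = VectorField.mpullbackWithin 𝓘(ℝ, E) I ψ.symm U Set.univ ∧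
        DifferentiableAt ℝ U' (ψ v) ∧
        (∀ᶠ y in 𝓝 (ψ v), ψ.symm y ∈ S → fderiv ℝ F y (U' y) = 0) ∧
        ∃ c : ℝ → E, c 0 = ψ v ∧ HasDerivAt c (U' (ψ v)) 0 ∧
          ∀ᶠ t in 𝓝 (0 : ℝ), ψ.symm (c t) ∈ S := by
    intro U hU hUS
    have hd := (hU.mdifferentiableWithinAt
      (s := Set.univ)).differentiableWithinAt_mpullbackWithin_vectorField
    rw [I.range_eq_univ, Set.preimage_univ, Set.univ_inter] at hd
    replace hd := differentiableWithinAt_univ (E := E) (F := E).1 hd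
    -- Pulling back along `ψ.symm` inverts its derivative, which is the same as applying the
    -- derivative of `ψ`.
    have hU' : ∀ y ∈ ψ.target, (VectorField.mpullbackWithin 𝓘(ℝ, E) I ψ.symm U Set.univ y : E)
        = mfderiv I 𝓘(ℝ, E) ψ (ψ.symm y) (U (ψ.symm y)) := by
      intro y hy
      have h1 := mfderiv_extChartAt_comp_mfderivWithin_extChartAt_symm hy
      have h2 := mfderivWithin_extChartAt_symm_comp_mfderiv_extChartAt hy
      rw [I.range_eq_univ] at h1 h2
      rw [VectorField.mpullbackWithin_apply]
      exact congrArg (fun T ↦ T (U (ψ.symm y))) (ContinuousLinearMap.inverse_eq h2 h1)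
    have hψs : Filter.Tendsto ψ.symm (𝓝 (ψ v)) (𝓝 v) := by
      simpa [hψ] using (continuousAt_extChartAt_symm (I := I) v).tendsto
    refine ⟨_, rfl, hd, ?_, ?_⟩
    · filter_upwards [h.eventually_fderiv_eq_zero, hψs.eventually hUS,
        extChartAt_target_mem_nhds (I := I) v] with y h1 h2 hy hyS
      have h3 := h1 _ (h2 hyS)
      rw [← hU' y hy] at h3
      exact h3
    · obtain ⟨c, h1, h2, h3⟩ :=
        exists_curve_of_mem_velocitySet (mem_extChartAt_source v) (hUS.self_of_nhds hv)
      refine ⟨c, h1, ?_, h3⟩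
      have h4 := hU' (ψ v) (mem_extChartAt_target v)
      have h5 : ψ.symm (ψ v) = v := extChartAt_to_inv v
      rw [h4]
      convert h2 using 1
      rw [h5]
  obtain ⟨V', hV', hVd, hVF, c, hc0, hc, hcS⟩ := key V hV hVS
  obtain ⟨W', hW', hWd, hWF, d, hd0, hd, hdS⟩ := key W hW hWS
  have hb := fderiv_lieBracket_eq_zero (D := ψ.symm ⁻¹' S) (h.1.of_le le_top) hVd hWd hVF hWF
    hc0 hc hcS hd0 hd hdS
  rw [h.mem_velocitySet_iff]
  have e : VectorField.mlieBracket I V W v = VectorField.lieBracket ℝ V' W' (ψ v) := by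
    -- The chart at `v` has identity derivative at `v`, so there the manifold bracket is the bracket
    -- of the chart representatives.
    have hi : ∀ u : E, ((mfderiv I 𝓘(ℝ, E) (extChartAt I v) v).inverse u : E) = u := by
      intro u
      rw [mfderiv_extChartAt_self]
      exact congrArg (fun T : E →L[ℝ] E ↦ T u) ContinuousLinearMap.inverse_id
    rw [← VectorField.mlieBracketWithin_univ, VectorField.mlieBracketWithin_apply,
      hV', hW', I.range_eq_univ, Set.preimage_univ, Set.univ_inter]
    exact (hi _).trans (congrFun VectorField.lieBracketWithin_univ (ψ v))
  rw [e]
  exact hb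

end IsZeroSetAt

end Submanifold

theorem LocallyConstantRankAt.eventually {E : Type*} [NormedAddCommGroup E] [NormedSpace ℝ E]
    {Q : Type*} [TopologicalSpace Q] [ChartedSpace E Q]
    {D : (q : Q) → Submodule ℝ (TangentSpace 𝓘(ℝ, E) q)}
    {q : Q} (h : LocallyConstantRankAt D q) : ∀ᶠ p in 𝓝 q, LocallyConstantRankAt D p := by
  filter_upwards [Filter.Eventually.eventually_nhds h, h] with p h1 h2
  filter_upwards [h1] with p' h3 using h3.trans h2.symm

/-! ### The symmetric closure and its distribution as a local zero set. -/

section Distribution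

variable {E : Type*} [NormedAddCommGroup E] [NormedSpace ℝ E]
  {Q : Type*} [TopologicalSpace Q] [ChartedSpace E Q] [IsManifold 𝓘(ℝ, E) ω Q]

theorem tangentSet_eq_velocitySet (S : Set (TangentBundle 𝓘(ℝ, E) Q))
    (v : TangentBundle 𝓘(ℝ, E) Q) : tangentSet S v = velocitySet 𝓘(ℝ, E).tangent S v := rfl


theorem IsAnalyticVectorField.nabla {nabla : AffineConnection E Q}
    (hnabla : IsAnalyticConnection nabla) {X Y : (q : Q) → TangentSpace 𝓘(ℝ, E) q}
    (hX : IsAnalyticVectorField X) (hY : IsAnalyticVectorField Y) :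
    IsAnalyticVectorField (fun q ↦ nabla Y q (X q)) := by
  have h1 := (hnabla Set.univ isOpen_univ).contMDiff (σ := Y) (by
    rw [contMDiffOn_univ]; exact hY)
  rw [contMDiffOn_univ] at h1
  exact h1.clm_bundle_apply hX

theorem IsAnalyticVectorField.symProd {nabla : AffineConnection E Q}
    (hnabla : IsAnalyticConnection nabla) {X Y : (q : Q) → TangentSpace 𝓘(ℝ, E) q}
    (hX : IsAnalyticVectorField X) (hY : IsAnalyticVectorField Y) :
    IsAnalyticVectorField (symProd nabla X Y) :=
  ContMDiff.add_section (hX.nabla hnabla hY) (hY.nabla hnabla hX)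

/-- The analytic fields are one of the subspaces over which the defining infimum is taken. -/
theorem isAnalyticVectorField_of_mem_symClosure {nabla : AffineConnection E Q}
    (hnabla : IsAnalyticConnection nabla) {𝒴 : Set ((q : Q) → TangentSpace 𝓘(ℝ, E) q)}
    (h𝒴 : ∀ Y ∈ 𝒴, IsAnalyticVectorField Y) {X : (q : Q) → TangentSpace 𝓘(ℝ, E) q}
    (hX : X ∈ symClosure nabla 𝒴) : IsAnalyticVectorField X := by
  let S : Submodule ℝ ((q : Q) → TangentSpace 𝓘(ℝ, E) q) :=
    { carrier := {X | IsAnalyticVectorField X}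
      add_mem' := fun hX hY ↦ ContMDiff.add_section hX hY
      zero_mem' := Bundle.contMDiff_zeroSection ℝ (TangentSpace 𝓘(ℝ, E) : Q → Type _)
      smul_mem' := fun a _ hX ↦ ContMDiff.const_smul_section (a := a) hX }
  have hS : symClosure nabla 𝒴 ≤ S :=
    sInf_le ⟨h𝒴, fun X hX Y hY ↦ IsAnalyticVectorField.symProd hnabla hX hY⟩
  exact hS hX

theorem subset_symClosure (nabla : AffineConnection E Q)
    (𝒴 : Set ((q : Q) → TangentSpace 𝓘(ℝ, E) q)) : 𝒴 ⊆ symClosure nabla 𝒴 := by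
  intro X hX
  exact Submodule.mem_sInf.2 fun S hS ↦ hS.1 hX

theorem symProd_mem_symClosure {nabla : AffineConnection E Q}
    {𝒴 : Set ((q : Q) → TangentSpace 𝓘(ℝ, E) q)} {X Y : (q : Q) → TangentSpace 𝓘(ℝ, E) q}
    (hX : X ∈ symClosure nabla 𝒴) (hY : Y ∈ symClosure nabla 𝒴) :
    symProd nabla X Y ∈ symClosure nabla 𝒴 :=
  Submodule.mem_sInf.2 fun S hS ↦
    hS.2 X (Submodule.mem_sInf.1 hX S hS) Y (Submodule.mem_sInf.1 hY S hS)

/-- `∇_X X = ½⟨X : X⟩`; this is how closure under the symmetric product enters the tangency of the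
spray. -/
theorem nabla_self_mem_symDistrib {nabla : AffineConnection E Q}
    {𝒴 : Set ((q : Q) → TangentSpace 𝓘(ℝ, E) q)} {X : (q : Q) → TangentSpace 𝓘(ℝ, E) q}
    (hX : X ∈ symClosure nabla 𝒴) (q : Q) : nabla X q (X q) ∈ symDistrib nabla 𝒴 q := by
  refine ⟨(2⁻¹ : ℝ) • symProd nabla X X,
    Submodule.smul_mem _ _ (symProd_mem_symClosure hX hX), ?_⟩
  change (2⁻¹ : ℝ) • (nabla X q (X q) + nabla X q (X q)) = nabla X q (X q)
  rw [← two_smul ℝ, smul_smul]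
  norm_num

theorem extChartAt_tangent_apply (v z : TangentBundle 𝓘(ℝ, E) Q) :
    extChartAt 𝓘(ℝ, E).tangent v z = (extChartAt 𝓘(ℝ, E) v.proj
      (trivializationAt E (TangentSpace 𝓘(ℝ, E)) v.proj z).1,
      (trivializationAt E (TangentSpace 𝓘(ℝ, E)) v.proj z).2) := by
  rw [FiberBundle.extChartAt]
  rfl

theorem extChartAt_tangent_symm_apply (v : TangentBundle 𝓘(ℝ, E) Q) (y : E × E) :
    (extChartAt 𝓘(ℝ, E).tangent v).symm y =
      (trivializationAt E (TangentSpace 𝓘(ℝ, E)) v.proj).toOpenPartialHomeomorph.symm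
        ((extChartAt 𝓘(ℝ, E) v.proj).symm y.1, y.2) := by
  rw [FiberBundle.extChartAt]
  rfl

/-- A distribution of locally constant rank with an analytic frame at `v.proj` is near `v` the zero
set of an analytic map, as a subset of the tangent bundle. -/
theorem exists_isZeroSetAt_distribTotal [FiniteDimensional ℝ E]
    {D : (q : Q) → Submodule ℝ (TangentSpace 𝓘(ℝ, E) q)} {v : TangentBundle 𝓘(ℝ, E) Q}
    {ι : Type*} [Fintype ι] {X : ι → (q : Q) → TangentSpace 𝓘(ℝ, E) q}
    (hX : ∀ i, IsAnalyticVectorField (X i)) (hXD : ∀ i q, X i q ∈ D q)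
    (hli : LinearIndependent ℝ (fun i ↦ X i v.proj))
    (hcard : Fintype.card ι = Module.finrank ℝ (D v.proj))
    (hrank : LocallyConstantRankAt D v.proj) (hv : v ∈ distribTotal D) :
    ∃ F : E × E → E, IsZeroSetAt 𝓘(ℝ, E).tangent E (distribTotal D) v F := by
  set q := v.proj with hq
  set e := trivializationAt E (TangentSpace 𝓘(ℝ, E)) q with he
  set φ := extChartAt 𝓘(ℝ, E) q with hφ
  have hqe : q ∈ e.baseSet := FiberBundle.mem_baseSet_trivializationAt' q
  have hφs : Filter.Tendsto φ.symm (𝓝 (φ q)) (𝓝 q) := by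
    simpa [hφ] using (continuousAt_extChartAt_symm (I := 𝓘(ℝ, E)) q).tendsto
  have hφq : φ.symm (φ q) = q := extChartAt_to_inv q
  let X' : ι → E → E := fun i x ↦ (e ⟨φ.symm x, X i (φ.symm x)⟩).2
  have hX' : ∀ i, ContDiffAt ℝ ω (X' i) (φ q) := by
    intro i
    have h1 := (Bundle.contMDiffAt_section q).1 (hX i q)
    have h2 : ContMDiffAt 𝓘(ℝ, E) 𝓘(ℝ, E) ω φ.symm (φ q) :=
      (contMDiffOn_extChartAt_symm q).contMDiffAt (extChartAt_target_mem_nhds q)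
    exact (h1.comp_of_eq h2 hφq).contDiffAt
  -- Where the frame stays independent and the rank is unchanged, a dimension count shows that the
  -- frame spans `D p`.
  have hD : ∀ p (hp : p ∈ e.baseSet),
      (LinearIndependent ℝ fun i ↦ e.continuousLinearEquivAt ℝ p hp (X i p)) →
      Module.finrank ℝ (D p) = Module.finrank ℝ (D q) → ∀ a : E,
      (e.continuousLinearEquivAt ℝ p hp).symm a ∈ D p ↔
        a ∈ Submodule.span ℝ (Set.range fun i ↦ e.continuousLinearEquivAt ℝ p hp (X i p)) := by
    intro p hp hlip hrp a
    have : FiniteDimensional ℝ (TangentSpace 𝓘(ℝ, E) p) := inferInstanceAs (FiniteDimensional ℝ E)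
    let T := (e.continuousLinearEquivAt ℝ p hp).toLinearEquiv
    have h1 : LinearIndependent ℝ fun i ↦ X i p :=
      LinearIndependent.of_comp T.toLinearMap hlip
    have h2 : Submodule.span ℝ (Set.range fun i ↦ X i p) = D p := by
      refine Submodule.eq_of_le_of_finrank_eq
        (Submodule.span_le.2 (by rintro _ ⟨i, rfl⟩; exact hXD i p)) ?_
      rw [finrank_span_eq_card h1, hcard, hrp]
    have h3 : Submodule.span ℝ (Set.range fun i ↦ e.continuousLinearEquivAt ℝ p hp (X i p))
        = (D p).map T.toLinearMap := by
      rw [← h2, Submodule.map_span, ← Set.range_comp]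
      rfl
    rw [h3]
    exact (Submodule.mem_map_equiv (e := T) (p := D p)).symm
  have hli' : LinearIndependent ℝ fun i ↦ X' i (φ q) := by
    have : ∀ p (hpq : p = q), LinearIndependent ℝ fun i ↦ (e ⟨p, X i p⟩).2 := by
      rintro p rfl
      exact hli.map' (e.continuousLinearEquivAt ℝ q hqe).toLinearEquiv.toLinearMap
        (LinearEquiv.ker _)
    exact this _ hφq
  obtain ⟨hlin, F, hF, hF0, hFc⟩ := exists_defining_map hX' hli'
  have hmem : ∀ᶠ x in 𝓝 (φ q), ∀ a, (extChartAt 𝓘(ℝ, E).tangent v).symm (x, a) ∈ distribTotal D ↔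
      a ∈ Submodule.span ℝ (Set.range fun i ↦ X' i x) := by
    filter_upwards [hlin, hφs.eventually hrank, hφs.eventually (e.open_baseSet.mem_nhds hqe)]
      with x h1 h2 h3 a
    rw [extChartAt_tangent_symm_apply]
    have h4 : e.toOpenPartialHomeomorph.symm (φ.symm x, a) =
        ⟨φ.symm x, (e.continuousLinearEquivAt ℝ (φ.symm x) h3).symm a⟩ :=
      (e.mk_symm h3 a).symm
    rw [h4]
    exact hD _ h3 h1 h2 a
  have hψv : extChartAt 𝓘(ℝ, E).tangent v v = (φ q, (e v).2) := by
    rw [extChartAt_tangent_apply, e.coe_fst' hqe]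
  refine ⟨F, ?_, ?_, ?_⟩
  · rw [hψv]; exact hF _
  · rw [hψv]
    have : Filter.Tendsto Prod.fst (𝓝 (φ q, (e v).2)) (𝓝 (φ q)) := continuousAt_fst
    filter_upwards [this.eventually hmem, this.eventually hF0] with y h1 h2
    rw [h2 y.2]
    exact h1 y.2
  · rw [hψv]
    refine hFc _ ?_
    rw [← hmem.self_of_nhds, ← hψv, extChartAt_to_inv]
    exact hv

theorem exists_frame [FiniteDimensional ℝ E] (nabla : AffineConnection E Q)
    (𝒴 : Set ((q : Q) → TangentSpace 𝓘(ℝ, E) q)) (q : Q) :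
    ∃ X : Fin (Module.finrank ℝ (symDistrib nabla 𝒴 q)) → (q : Q) → TangentSpace 𝓘(ℝ, E) q,
      (∀ i, X i ∈ symClosure nabla 𝒴) ∧ LinearIndependent ℝ (fun i ↦ X i q) := by
  have : FiniteDimensional ℝ (TangentSpace 𝓘(ℝ, E) q) := inferInstanceAs (FiniteDimensional ℝ E)
  let b := Module.finBasis ℝ (symDistrib nabla 𝒴 q)
  choose X hX hXb using fun i ↦ (b i).2
  refine ⟨X, hX, ?_⟩
  have : (fun i ↦ X i q) = fun i ↦ (b i : TangentSpace 𝓘(ℝ, E) q) := funext hXb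
  rw [this]
  exact b.linearIndependent.map' (Submodule.subtype _) (Submodule.ker_subtype _)

theorem exists_isZeroSetAt_symDistrib [FiniteDimensional ℝ E] {nabla : AffineConnection E Q}
    (hnabla : IsAnalyticConnection nabla) {𝒴 : Set ((q : Q) → TangentSpace 𝓘(ℝ, E) q)}
    (h𝒴 : ∀ Y ∈ 𝒴, IsAnalyticVectorField Y) {v : TangentBundle 𝓘(ℝ, E) Q}
    (hrank : LocallyConstantRankAt (symDistrib nabla 𝒴) v.proj)
    (hv : v ∈ distribTotal (symDistrib nabla 𝒴)) :
    ∃ F : E × E → E,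
      IsZeroSetAt 𝓘(ℝ, E).tangent E (distribTotal (symDistrib nabla 𝒴)) v F := by
  obtain ⟨X, hX, hli⟩ := exists_frame nabla 𝒴 v.proj
  exact exists_isZeroSetAt_distribTotal
    (fun i ↦ isAnalyticVectorField_of_mem_symClosure hnabla h𝒴 (hX i))
    (fun i q ↦ ⟨X i, hX i, rfl⟩) hli (Fintype.card_fin _) hrank hv

end Distribution

/-! ### Chart components of vertical lifts and of sections. -/

section Lifts

variable {E : Type*} [NormedAddCommGroup E] [NormedSpace ℝ E]
  {Q : Type*} [TopologicalSpace Q] [ChartedSpace E Q] [IsManifold 𝓘(ℝ, E) ω Q]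

/-- The components of a tangent vector to `TQ` in the chart at `v₀`. -/
def tangentCoord (v₀ z : TangentBundle 𝓘(ℝ, E) Q) : TangentSpace 𝓘(ℝ, E).tangent z →L[ℝ] E × E :=
  mvfderiv 𝓘(ℝ, E).tangent (extChartAt 𝓘(ℝ, E).tangent v₀) z

theorem tangentCoord_self (v : TangentBundle 𝓘(ℝ, E) Q) (w : TangentSpace 𝓘(ℝ, E).tangent v) :
    tangentCoord v v w = w := by
  have h := mfderiv_extChartAt_self (I := 𝓘(ℝ, E).tangent) (x := v)
  exact congrArg (fun T ↦ T w) h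

/-- The chart of `TQ` pairs the base chart with the fibre coordinate, so derivatives can be computed
one component at a time. -/
theorem tangentCoord_mfderiv {E' : Type*} [NormedAddCommGroup E'] [NormedSpace ℝ E']
    {H' : Type*} [TopologicalSpace H'] {I' : ModelWithCorners ℝ E' H'}
    {M : Type*} [TopologicalSpace M] [ChartedSpace H' M] {f : M → TangentBundle 𝓘(ℝ, E) Q} {x : M}
    (hf : MDifferentiableAt I' 𝓘(ℝ, E).tangent f x) (v₀ : TangentBundle 𝓘(ℝ, E) Q)
    (hx : (f x).proj ∈ (chartAt E v₀.proj).source) (w : TangentSpace I' x) :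
    tangentCoord v₀ (f x) (mfderiv I' 𝓘(ℝ, E).tangent f x w) =
      (mvfderiv I' (fun y ↦ extChartAt 𝓘(ℝ, E) v₀.proj (f y).proj) x w,
       mvfderiv I' (fun y ↦ (trivializationAt E (TangentSpace 𝓘(ℝ, E)) v₀.proj (f y)).2) x w) := by
  set e := trivializationAt E (TangentSpace 𝓘(ℝ, E)) v₀.proj with he
  have hxe : (f x).proj ∈ e.baseSet := by simpa [he] using hx
  have hψ : MDifferentiableAt 𝓘(ℝ, E).tangent 𝓘(ℝ, E × E) (extChartAt 𝓘(ℝ, E).tangent v₀) (f x) :=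
    mdifferentiableAt_extChartAt (by
      rw [TangentBundle.mem_chart_source_iff]; exact hx)
  have h1 := (hψ.comp x hf).hasMFDerivAt
  have hfst : HasMFDerivAt I' 𝓘(ℝ, E) (fun y ↦ extChartAt 𝓘(ℝ, E) v₀.proj (f y).proj) x
      ((ContinuousLinearMap.fst ℝ E E).comp
        (mvfderiv I' (extChartAt 𝓘(ℝ, E).tangent v₀ ∘ f) x)) := by
    have h2 : HasMFDerivAt I' 𝓘(ℝ, E) (Prod.fst ∘ extChartAt 𝓘(ℝ, E).tangent v₀ ∘ f) x
      ((ContinuousLinearMap.fst ℝ E E).comp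
        (mvfderiv I' (extChartAt 𝓘(ℝ, E).tangent v₀ ∘ f) x)) :=
      HasMFDerivAt.comp x (ContinuousLinearMap.fst ℝ E E).hasMFDerivAt h1
    refine h2.congr_of_eventuallyEq ?_
    have hc : ContinuousAt (fun y ↦ (f y).proj) x :=
      (FiberBundle.continuous_proj E (TangentSpace 𝓘(ℝ, E))).continuousAt.comp hf.continuousAt
    filter_upwards [hc.eventually (e.open_baseSet.mem_nhds hxe)] with y hy
    rw [Function.comp_apply, Function.comp_apply, extChartAt_tangent_apply, e.coe_fst' hy]
  have hsnd : HasMFDerivAt I' 𝓘(ℝ, E) (fun y ↦ (e (f y)).2) x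
      ((ContinuousLinearMap.snd ℝ E E).comp
        (mvfderiv I' (extChartAt 𝓘(ℝ, E).tangent v₀ ∘ f) x)) := by
    have h2 : HasMFDerivAt I' 𝓘(ℝ, E) (Prod.snd ∘ extChartAt 𝓘(ℝ, E).tangent v₀ ∘ f) x
      ((ContinuousLinearMap.snd ℝ E E).comp
        (mvfderiv I' (extChartAt 𝓘(ℝ, E).tangent v₀ ∘ f) x)) :=
      HasMFDerivAt.comp x (ContinuousLinearMap.snd ℝ E E).hasMFDerivAt h1
    have h3 : (fun y ↦ (e (f y)).2) = Prod.snd ∘ extChartAt 𝓘(ℝ, E).tangent v₀ ∘ f := by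
      funext y
      rw [Function.comp_apply, Function.comp_apply, extChartAt_tangent_apply]
    rw [h3]
    exact h2
  have h0 : tangentCoord v₀ (f x) (mfderiv I' 𝓘(ℝ, E).tangent f x w) =
      mvfderiv I' (extChartAt 𝓘(ℝ, E).tangent v₀ ∘ f) x w :=
    (mfderiv_comp_apply x hψ hf w).symm
  rw [h0]
  refine Prod.ext ?_ ?_
  · exact (congrArg (fun T ↦ T w) hfst.mfderiv).symm
  · exact (congrArg (fun T ↦ T w) hsnd.mfderiv).symm

theorem contMDiff_fiberLine (v : TangentBundle 𝓘(ℝ, E) Q) (x : TangentSpace 𝓘(ℝ, E) v.proj) :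
    ContMDiff 𝓘(ℝ, ℝ) 𝓘(ℝ, E).tangent ω
      (fun t : ℝ ↦ (⟨v.proj, v.2 + t • x⟩ : TangentBundle 𝓘(ℝ, E) Q)) := by
  intro t
  rw [Bundle.contMDiffAt_totalSpace]
  refine ⟨contMDiffAt_const, ?_⟩
  set e := trivializationAt E (TangentSpace 𝓘(ℝ, E)) v.proj with he
  have hl := e.linear ℝ (FiberBundle.mem_baseSet_trivializationAt' v.proj)
  have h1 : (fun t : ℝ ↦ (e ⟨v.proj, v.2 + t • x⟩).2) =
      fun t ↦ (e ⟨v.proj, v.2⟩).2 + t • (e ⟨v.proj, x⟩).2 := by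
    funext t
    rw [hl.map_add, hl.map_smul]
  rw [h1]
  exact (ContDiff.contMDiff (by fun_prop)).contMDiffAt

theorem tangentCoord_vlft (v₀ v : TangentBundle 𝓘(ℝ, E) Q)
    (hv : v.proj ∈ (chartAt E v₀.proj).source) (x : TangentSpace 𝓘(ℝ, E) v.proj) :
    tangentCoord v₀ v (vlft v x) =
      (0, (trivializationAt E (TangentSpace 𝓘(ℝ, E)) v₀.proj ⟨v.proj, x⟩).2) := by
  set e := trivializationAt E (TangentSpace 𝓘(ℝ, E)) v₀.proj with he
  have hve : v.proj ∈ e.baseSet := by simpa [he] using hv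
  have hl := e.linear ℝ hve
  set f : ℝ → TangentBundle 𝓘(ℝ, E) Q := fun t ↦ ⟨v.proj, v.2 + t • x⟩ with hf
  have hf0 : f 0 = v := by simp [hf]
  have h := tangentCoord_mfderiv (f := f) (x := (0 : ℝ))
    ((contMDiff_fiberLine v x 0).mdifferentiableAt (by simp)) v₀ hv (1 : ℝ)
  have e1 : tangentCoord v₀ (f 0) (mfderiv 𝓘(ℝ, ℝ) 𝓘(ℝ, E).tangent f 0 (1 : ℝ)) =
      tangentCoord v₀ v (vlft v x) := by
    -- `f 0` has fibre part `v.2 + 0 • x`, hence equals `v` only propositionally; generalising the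
    -- endpoint permits substitution.
    have : ∀ z (hz : f 0 = z), tangentCoord v₀ (f 0) (mfderiv 𝓘(ℝ, ℝ) 𝓘(ℝ, E).tangent f 0 (1 : ℝ)) =
      tangentCoord v₀ z (mfderiv 𝓘(ℝ, ℝ) 𝓘(ℝ, E).tangent f 0 (1 : ℝ) : E × E) := by
      rintro z rfl; rfl
    exact this v hf0
  rw [← e1, h]
  refine Prod.ext ?_ ?_
  · exact congrArg (fun T : ℝ →L[ℝ] E ↦ T 1)
      (mvfderiv_const (I := 𝓘(ℝ, ℝ)) (x := (0 : ℝ)) (extChartAt 𝓘(ℝ, E) v₀.proj v.proj))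
  · have h1 : (fun t : ℝ ↦ (e (f t)).2) =
        fun t ↦ (e ⟨v.proj, v.2⟩).2 + t • (e ⟨v.proj, x⟩).2 := by
      funext t
      rw [hf]
      simp only
      rw [hl.map_add, hl.map_smul]
    change mvfderiv 𝓘(ℝ, ℝ) (fun t : ℝ ↦ (e (f t)).2) 0 (1 : ℝ) = _
    rw [h1]
    have h2 : HasDerivAt (fun t : ℝ ↦ (e ⟨v.proj, v.2⟩).2 + t • (e ⟨v.proj, x⟩).2)
        (e ⟨v.proj, x⟩).2 0 := by
      simpa using ((hasDerivAt_id (0 : ℝ)).smul_const (e ⟨v.proj, x⟩).2).const_add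
        (e ⟨v.proj, v.2⟩).2
    have h3 := h2.hasFDerivAt.hasMFDerivAt.mfderiv
    refine (congrArg (fun T : ℝ →L[ℝ] E ↦ T 1) h3).trans ?_
    simp

theorem tangentCoord_section (v₀ v : TangentBundle 𝓘(ℝ, E) Q)
    (hv : v.proj ∈ (chartAt E v₀.proj).source) {X : (q : Q) → TangentSpace 𝓘(ℝ, E) q}
    (hX : MDifferentiableAt 𝓘(ℝ, E) 𝓘(ℝ, E).tangent
      (fun q ↦ (⟨q, X q⟩ : TangentBundle 𝓘(ℝ, E) Q)) v.proj)
    (hXv : X v.proj = v.2) (x : TangentSpace 𝓘(ℝ, E) v.proj) :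
    tangentCoord v₀ v (mfderiv 𝓘(ℝ, E) 𝓘(ℝ, E).tangent
        (fun q ↦ (⟨q, X q⟩ : TangentBundle 𝓘(ℝ, E) Q)) v.proj x : E × E) =
      ((trivializationAt E (TangentSpace 𝓘(ℝ, E)) v₀.proj ⟨v.proj, x⟩).2,
       mvfderiv 𝓘(ℝ, E)
        (fun q ↦ (trivializationAt E (TangentSpace 𝓘(ℝ, E)) v₀.proj ⟨q, X q⟩).2) v.proj x) := by
  obtain ⟨q, u⟩ := v
  change X q = u at hXv
  subst hXv
  have h := tangentCoord_mfderiv (f := fun q ↦ (⟨q, X q⟩ : TangentBundle 𝓘(ℝ, E) Q)) (x := q)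
    hX v₀ hv x
  refine h.trans (Prod.ext ?_ rfl)
  have h1 := TangentBundle.continuousLinearMapAt_trivializationAt (I := 𝓘(ℝ, E)) hv
  have h2 := Bundle.Trivialization.continuousLinearMapAt_apply_of_mem (R := ℝ)
    (trivializationAt E (TangentSpace 𝓘(ℝ, E)) v₀.proj) (b := q) (by simpa using hv) x
  rw [← h2, h1]
  rfl

end Lifts

/-! ### Horizontal lifts, Christoffel terms and smoothness of the generators. -/

section Spray

variable {E : Type*} [NormedAddCommGroup E] [NormedSpace ℝ E]
  {Q : Type*} [TopologicalSpace Q] [ChartedSpace E Q] [IsManifold 𝓘(ℝ, E) ω Q]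

/-- The flat derivative of the chart and `∇` have the same Leibniz term, which cancels in the
difference. Thus the difference depends only on `X q`, and the extension chosen in `hlft` may be
replaced by any other. -/
theorem tensorialAt_mvfderiv_sub_nabla (nabla : AffineConnection E Q) (q₀ : Q) {q : Q}
    (hq : q ∈ (trivializationAt E (TangentSpace 𝓘(ℝ, E)) q₀).baseSet)
    (x : TangentSpace 𝓘(ℝ, E) q) :
    TensorialAt 𝓘(ℝ, E) E (fun X : (p : Q) → TangentSpace 𝓘(ℝ, E) p ↦
      (mvfderiv 𝓘(ℝ, E) (fun p ↦ (trivializationAt E (TangentSpace 𝓘(ℝ, E)) q₀ ⟨p, X p⟩).2) q x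
        - (trivializationAt E (TangentSpace 𝓘(ℝ, E)) q₀ ⟨q, nabla X q x⟩).2 : E)) q := by
  set e := trivializationAt E (TangentSpace 𝓘(ℝ, E)) q₀ with he
  have hmem := e.open_baseSet.mem_nhds hq
  have hl := e.linear ℝ hq
  constructor
  · intro f σ hf hσ
    have hσ' := (e.mdifferentiableAt_section_iff 𝓘(ℝ, E) σ hq).1 hσ
    have h1 : (fun p ↦ (e ⟨p, (f • σ) p⟩).2) =ᶠ[𝓝 q] f • fun p ↦ (e ⟨p, σ p⟩).2 := by
      filter_upwards [hmem] with p hp using (e.linear ℝ hp).map_smul (f p) (σ p)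
    have h2 : mvfderiv 𝓘(ℝ, E) (fun p ↦ (e ⟨p, (f • σ) p⟩).2) q x =
        mvfderiv 𝓘(ℝ, E) (f • fun p ↦ (e ⟨p, σ p⟩).2) q x :=
      congrArg (fun T : E →L[ℝ] E ↦ T x) h1.mfderiv_eq
    rw [h2, mvfderiv_smul hf hσ', nabla.isCovariantDerivativeOnUniv.leibniz hσ hf]
    have h3 := hl.map_add (f q • nabla σ q x) (mvfderiv 𝓘(ℝ, E) f q x • σ q)
    rw [hl.map_smul, hl.map_smul] at h3
    refine (congrArg₂ (fun a b : E ↦ a - b) rfl h3).trans ?_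
    simp only [add_apply, smul_apply,
      ContinuousLinearMap.smulRight_apply]
    rw [smul_sub]
    abel
  · intro σ σ' hσ hσ'
    have hσe := (e.mdifferentiableAt_section_iff 𝓘(ℝ, E) σ hq).1 hσ
    have hσe' := (e.mdifferentiableAt_section_iff 𝓘(ℝ, E) σ' hq).1 hσ'
    have h1 : (fun p ↦ (e ⟨p, (σ + σ') p⟩).2) =ᶠ[𝓝 q]
        (fun p ↦ (e ⟨p, σ p⟩).2) + fun p ↦ (e ⟨p, σ' p⟩).2 := by
      filter_upwards [hmem] with p hp using (e.linear ℝ hp).map_add (σ p) (σ' p)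
    have h2 : mvfderiv 𝓘(ℝ, E) (fun p ↦ (e ⟨p, (σ + σ') p⟩).2) q x =
        mvfderiv 𝓘(ℝ, E) ((fun p ↦ (e ⟨p, σ p⟩).2) + fun p ↦ (e ⟨p, σ' p⟩).2) q x :=
      congrArg (fun T : E →L[ℝ] E ↦ T x) h1.mfderiv_eq
    rw [h2, mvfderiv_add hσe hσe', nabla.isCovariantDerivativeOnUniv.add hσ hσ']
    have h3 := hl.map_add (nabla σ q x) (nabla σ' q x)
    refine (congrArg₂ (fun a b : E ↦ a - b) rfl h3).trans ?_
    simp only [add_apply]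
    abel

theorem tangentCoord_hlft [FiniteDimensional ℝ E] (nabla : AffineConnection E Q)
    (v₀ v : TangentBundle 𝓘(ℝ, E) Q)
    (hv : v.proj ∈ (chartAt E v₀.proj).source) {X : (q : Q) → TangentSpace 𝓘(ℝ, E) q}
    (hX : MDifferentiableAt 𝓘(ℝ, E) 𝓘(ℝ, E).tangent
      (fun q ↦ (⟨q, X q⟩ : TangentBundle 𝓘(ℝ, E) Q)) v.proj)
    (hXv : X v.proj = v.2) (x : TangentSpace 𝓘(ℝ, E) v.proj) :
    tangentCoord v₀ v (hlft nabla v x) =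
      ((trivializationAt E (TangentSpace 𝓘(ℝ, E)) v₀.proj ⟨v.proj, x⟩).2,
       mvfderiv 𝓘(ℝ, E)
        (fun q ↦ (trivializationAt E (TangentSpace 𝓘(ℝ, E)) v₀.proj ⟨q, X q⟩).2) v.proj x -
       (trivializationAt E (TangentSpace 𝓘(ℝ, E)) v₀.proj ⟨v.proj, nabla X v.proj x⟩).2) := by
  have hve : v.proj ∈ (trivializationAt E (TangentSpace 𝓘(ℝ, E)) v₀.proj).baseSet := by
    simpa using hv
  have hV := FiberBundle.mdifferentiableAt_extend 𝓘(ℝ, E) E v.2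
  have hVv : FiberBundle.extend E v.2 v.proj = v.2 := FiberBundle.extend_apply_self E v.2
  have h1 := (tensorialAt_mvfderiv_sub_nabla nabla v₀.proj hve x).pointwise hX hV
    (hXv.trans hVv.symm)
  have h2 := tangentCoord_section v₀ v hv hV hVv x
  have h3 := tangentCoord_vlft v₀ v hv (nabla (FiberBundle.extend E v.2) v.proj x)
  have h4 := (tangentCoord v₀ v).map_sub
    (mfderiv 𝓘(ℝ, E) 𝓘(ℝ, E).tangent
        (fun q ↦ (⟨q, FiberBundle.extend E v.2 q⟩ : TangentBundle 𝓘(ℝ, E) Q)) v.proj x : E × E)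
    (vlft v (nabla (FiberBundle.extend E v.2) v.proj x))
  rw [h3] at h4
  refine (h4.trans (congrArg (fun a : E × E ↦ a - _) h2)).trans ?_
  refine Prod.ext (sub_zero _) h1.symm

/-- In the chart at `v₀`, `∇ₓ` of the field with constant components `a`. -/
def christoffel (nabla : AffineConnection E Q) (q₀ : Q) (a : E) (v : TangentBundle 𝓘(ℝ, E) Q) : E :=
  (trivializationAt E (TangentSpace 𝓘(ℝ, E)) q₀ ⟨v.proj, nabla
    (fun q ↦ (trivializationAt E (TangentSpace 𝓘(ℝ, E)) q₀).symmL ℝ q a) v.proj v.2⟩).2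

theorem contMDiffOn_symmL (q₀ : Q) (a : E) :
    ContMDiffOn 𝓘(ℝ, E) 𝓘(ℝ, E).tangent ω
      (fun q ↦ (⟨q, (trivializationAt E (TangentSpace 𝓘(ℝ, E)) q₀).symmL ℝ q a⟩ :
        TangentBundle 𝓘(ℝ, E) Q)) (trivializationAt E (TangentSpace 𝓘(ℝ, E)) q₀).baseSet := by
  set e := trivializationAt E (TangentSpace 𝓘(ℝ, E)) q₀ with he
  intro q hq
  rw [e.contMDiffWithinAt_section _ hq]
  refine (contMDiffWithinAt_const (c := a)).congr ?_ ?_ <;>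
  · intros
    rw [← e.continuousLinearMapAt_apply_of_mem (R := ℝ) (by assumption),
      e.continuousLinearMapAt_symmL (by assumption)]

theorem contMDiffAt_christoffel {nabla : AffineConnection E Q}
    (hnabla : IsAnalyticConnection nabla) (v₀ : TangentBundle 𝓘(ℝ, E) Q) (a : E) :
    ContMDiffAt 𝓘(ℝ, E).tangent 𝓘(ℝ, E) ω (christoffel nabla v₀.proj a) v₀ := by
  set e := trivializationAt E (TangentSpace 𝓘(ℝ, E)) v₀.proj with he
  have hq : v₀.proj ∈ e.baseSet := FiberBundle.mem_baseSet_trivializationAt' v₀.proj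
  have h1 := ((hnabla e.baseSet e.open_baseSet).contMDiff
    (σ := fun q ↦ e.symmL ℝ q a) (contMDiffOn_symmL v₀.proj a)).contMDiffAt
      (e.open_baseSet.mem_nhds hq)
  have h2 : ContMDiffAt 𝓘(ℝ, E).tangent 𝓘(ℝ, E) ω
    (Bundle.TotalSpace.proj : TangentBundle 𝓘(ℝ, E) Q → Q) v₀ := Bundle.contMDiffAt_proj _
  have h3 := ContMDiffAt.clm_bundle_apply (h1.comp v₀ h2)
    (v := fun v : TangentBundle 𝓘(ℝ, E) Q ↦ v.2) contMDiffAt_id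
  exact (Bundle.contMDiffAt_totalSpace.1 h3).2

/-- Analyticity of `christoffel` is known for each fixed `a`, but the spray uses `a` varying with
`v`; linearity reduces this to finitely many basis vectors. -/
theorem isLinearMap_christoffel (nabla : AffineConnection E Q) (q₀ : Q)
    {v : TangentBundle 𝓘(ℝ, E) Q}
    (hv : v.proj ∈ (trivializationAt E (TangentSpace 𝓘(ℝ, E)) q₀).baseSet) :
    IsLinearMap ℝ fun a ↦ christoffel nabla q₀ a v := by
  set e := trivializationAt E (TangentSpace 𝓘(ℝ, E)) q₀ with he
  have hl := e.linear ℝ hv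
  have hd : ∀ a, MDifferentiableAt 𝓘(ℝ, E) 𝓘(ℝ, E).tangent
      (fun q ↦ (⟨q, e.symmL ℝ q a⟩ : TangentBundle 𝓘(ℝ, E) Q)) v.proj := fun a ↦
    ((contMDiffOn_symmL q₀ a).contMDiffAt (e.open_baseSet.mem_nhds hv)).mdifferentiableAt (by simp)
  constructor
  · intro a b
    have h1 := nabla.isCovariantDerivativeOnUniv.add (hd a) (hd b)
    have h2 : (fun q ↦ e.symmL ℝ q (a + b)) = (fun q ↦ e.symmL ℝ q a) + fun q ↦ e.symmL ℝ q b := by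
      funext q; exact map_add _ _ _
    change (e ⟨v.proj, nabla (fun q ↦ e.symmL ℝ q (a + b)) v.proj v.2⟩).2 = _
    rw [h2, h1]
    exact hl.map_add _ _
  · intro c a
    have h1 := nabla.isCovariantDerivativeOnUniv.smul_const c (hd a)
    have h2 : (fun q ↦ e.symmL ℝ q (c • a)) = c • (fun q ↦ e.symmL ℝ q a) := by
      funext q; exact map_smul _ _ _
    change (e ⟨v.proj, nabla (fun q ↦ e.symmL ℝ q (c • a)) v.proj v.2⟩).2 = _
    rw [h2, h1]
    exact hl.map_smul _ _

/-- Extending `v` by the field with constant components in the chart at `v₀` makes the derivative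
term vanish. -/
theorem tangentCoord_geodesicSpray [FiniteDimensional ℝ E] (nabla : AffineConnection E Q)
    (v₀ v : TangentBundle 𝓘(ℝ, E) Q) (hv : v.proj ∈ (chartAt E v₀.proj).source) :
    tangentCoord v₀ v (geodesicSpray nabla v) =
      ((trivializationAt E (TangentSpace 𝓘(ℝ, E)) v₀.proj v).2,
       -christoffel nabla v₀.proj (trivializationAt E (TangentSpace 𝓘(ℝ, E)) v₀.proj v).2 v) := by
  set e := trivializationAt E (TangentSpace 𝓘(ℝ, E)) v₀.proj with he
  have hve : v.proj ∈ e.baseSet := by simpa [he] using hv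
  set a := (e v).2 with ha
  have hX : MDifferentiableAt 𝓘(ℝ, E) 𝓘(ℝ, E).tangent
      (fun q ↦ (⟨q, e.symmL ℝ q a⟩ : TangentBundle 𝓘(ℝ, E) Q)) v.proj :=
    ((contMDiffOn_symmL v₀.proj a).contMDiffAt
      (e.open_baseSet.mem_nhds hve)).mdifferentiableAt (by simp)
  have hXv : e.symmL ℝ v.proj a = v.2 := by
    have : a = e.continuousLinearMapAt ℝ v.proj v.2 := by
      rw [e.continuousLinearMapAt_apply_of_mem (R := ℝ) hve]
    rw [this, e.symmL_continuousLinearMapAt hve]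
  refine (tangentCoord_hlft nabla v₀ v hv hX hXv v.2).trans (Prod.ext rfl ?_)
  have h1 : (fun q ↦ (e ⟨q, e.symmL ℝ q a⟩).2) =ᶠ[𝓝 v.proj] fun _ ↦ a := by
    filter_upwards [e.open_baseSet.mem_nhds hve] with q hq
    rw [← e.continuousLinearMapAt_apply_of_mem (R := ℝ) hq, e.continuousLinearMapAt_symmL hq]
  have h2 : mvfderiv 𝓘(ℝ, E) (fun q ↦ (e ⟨q, e.symmL ℝ q a⟩).2) v.proj v.2 = 0 :=
    (congrArg (fun T : E →L[ℝ] E ↦ T v.2) h1.mfderiv_eq).trans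
      (congrArg (fun T : E →L[ℝ] E ↦ T v.2) (mvfderiv_const (I := 𝓘(ℝ, E)) (x := v.proj) a))
  exact (congrArg (fun z : E ↦ z - _) h2).trans (zero_sub _)

/-- Near `v₀` the fibre coordinate of `T(TQ)` trivialised at `v₀` is exactly `tangentCoord v₀`. -/
theorem contMDiffAt_of_tangentCoord {n : WithTop ℕ∞}
    {W : (v : TangentBundle 𝓘(ℝ, E) Q) → TangentSpace 𝓘(ℝ, E).tangent v}
    {v₀ : TangentBundle 𝓘(ℝ, E) Q} {f g : TangentBundle 𝓘(ℝ, E) Q → E}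
    (hf : ContMDiffAt 𝓘(ℝ, E).tangent 𝓘(ℝ, E) n f v₀)
    (hg : ContMDiffAt 𝓘(ℝ, E).tangent 𝓘(ℝ, E) n g v₀)
    (hW : ∀ v : TangentBundle 𝓘(ℝ, E) Q, v.proj ∈ (chartAt E v₀.proj).source →
      tangentCoord v₀ v (W v) = (f v, g v)) :
    ContMDiffAt 𝓘(ℝ, E).tangent 𝓘(ℝ, E).tangent.tangent n
      (fun v ↦ (⟨v, W v⟩ : TangentBundle 𝓘(ℝ, E).tangent (TangentBundle 𝓘(ℝ, E) Q))) v₀ := by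
  rw [Bundle.contMDiffAt_section]
  refine (hf.prodMk_space hg).congr_of_eventuallyEq ?_
  filter_upwards [(chartAt (ModelProd E E) v₀).open_source.mem_nhds (mem_chart_source _ v₀)]
    with v hv
  have h1 := TangentBundle.continuousLinearMapAt_trivializationAt (I := 𝓘(ℝ, E).tangent) hv
  have h2 := Bundle.Trivialization.continuousLinearMapAt_apply_of_mem (R := ℝ)
    (trivializationAt (E × E) (TangentSpace 𝓘(ℝ, E).tangent) v₀) (b := v) (by simpa using hv) (W v)
  rw [← hW v ((TangentBundle.mem_chart_source_iff v v₀).1 hv), ← h2, h1]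
  rfl

theorem contMDiff_verticalLift {X : (q : Q) → TangentSpace 𝓘(ℝ, E) q}
    (hX : IsAnalyticVectorField X) :
    ContMDiff 𝓘(ℝ, E).tangent 𝓘(ℝ, E).tangent.tangent ω
      (fun v ↦ (⟨v, verticalLift X v⟩ :
        TangentBundle 𝓘(ℝ, E).tangent (TangentBundle 𝓘(ℝ, E) Q))) := by
  intro v₀
  have h2 : ContMDiffAt 𝓘(ℝ, E).tangent 𝓘(ℝ, E) ω
    (Bundle.TotalSpace.proj : TangentBundle 𝓘(ℝ, E) Q → Q) v₀ := Bundle.contMDiffAt_proj _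
  have h1 := ((Bundle.contMDiffAt_section v₀.proj).1 (hX v₀.proj)).comp v₀ h2
  exact contMDiffAt_of_tangentCoord (contMDiffAt_const (c := (0 : E))) h1
    fun v hv ↦ tangentCoord_vlft v₀ v hv (X v.proj)

theorem contMDiff_geodesicSpray [FiniteDimensional ℝ E] {nabla : AffineConnection E Q}
    (hnabla : IsAnalyticConnection nabla) :
    ContMDiff 𝓘(ℝ, E).tangent 𝓘(ℝ, E).tangent.tangent ω
      (fun v ↦ (⟨v, geodesicSpray nabla v⟩ :
        TangentBundle 𝓘(ℝ, E).tangent (TangentBundle 𝓘(ℝ, E) Q))) := by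
  intro v₀
  set e := trivializationAt E (TangentSpace 𝓘(ℝ, E)) v₀.proj with he
  have h1 : ContMDiffAt 𝓘(ℝ, E).tangent 𝓘(ℝ, E) ω
      (fun v : TangentBundle 𝓘(ℝ, E) Q ↦ (e v).2) v₀ :=
    (Bundle.contMDiffAt_totalSpace.1 (contMDiffAt_id (x := v₀))).2
  let b := Module.finBasis ℝ E
  have h2 : ContMDiffAt 𝓘(ℝ, E).tangent 𝓘(ℝ, E) ω (fun v : TangentBundle 𝓘(ℝ, E) Q ↦
      -∑ i, b.equivFunL (e v).2 i • christoffel nabla v₀.proj (b i) v) v₀ := by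
    refine ContMDiffAt.neg (contMDiffAt_finsetSum fun i _ ↦ ?_)
    have h3 : ContDiff ℝ ω fun a : E ↦ b.equivFunL a i := by fun_prop
    have h4 : ContMDiffAt 𝓘(ℝ, E).tangent 𝓘(ℝ, ℝ) ω
        (fun v : TangentBundle 𝓘(ℝ, E) Q ↦ b.equivFunL (e v).2 i) v₀ :=
      h3.contMDiff.contMDiffAt.comp v₀ h1
    exact h4.smul (contMDiffAt_christoffel hnabla v₀ (b i))
  refine contMDiffAt_of_tangentCoord h1 h2 fun v hv ↦ ?_
  rw [tangentCoord_geodesicSpray nabla v₀ v hv]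
  refine congrArg (fun z : E ↦ ((e v).2, -z)) ?_
  have hve : v.proj ∈ e.baseSet := by simpa [he] using hv
  let T := (isLinearMap_christoffel nabla v₀.proj hve).mk' _
  have h3 : T (e v).2 = ∑ i, b.equivFunL (e v).2 i • T (b i) := by
    conv_lhs => rw [← b.sum_equivFun (e v).2]
    rw [map_sum]
    simp
  exact h3

theorem vlft_mem_tangentSet (D : (q : Q) → Submodule ℝ (TangentSpace 𝓘(ℝ, E) q))
    {v : TangentBundle 𝓘(ℝ, E) Q} (hv : v ∈ distribTotal D) {x : TangentSpace 𝓘(ℝ, E) v.proj}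
    (hx : x ∈ D v.proj) : vlft v x ∈ tangentSet (distribTotal D) v := by
  refine ⟨_, contMDiff_fiberLine v x 0, Filter.Eventually.of_forall fun t ↦
    (D v.proj).add_mem hv ((D v.proj).smul_mem t hx), ?_⟩
  exact tangentBundle_mk_eq (by simp) rfl

end Spray

/-! ### Tangency of the generators and of their brackets. -/

section Tangency

variable {E : Type*} [NormedAddCommGroup E] [NormedSpace ℝ E] [FiniteDimensional ℝ E]
  {Q : Type*} [TopologicalSpace Q] [ChartedSpace E Q] [IsManifold 𝓘(ℝ, E) ω Q]

theorem geodesicSpray_eq (nabla : AffineConnection E Q) {X : (q : Q) → TangentSpace 𝓘(ℝ, E) q}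
    {q : Q} (hX : MDifferentiableAt 𝓘(ℝ, E) 𝓘(ℝ, E).tangent
      (fun q ↦ (⟨q, X q⟩ : TangentBundle 𝓘(ℝ, E) Q)) q) :
    geodesicSpray nabla ⟨q, X q⟩ = mfderiv 𝓘(ℝ, E) 𝓘(ℝ, E).tangent
      (fun q ↦ (⟨q, X q⟩ : TangentBundle 𝓘(ℝ, E) Q)) q (X q) -
        vlft ⟨q, X q⟩ (nabla X q (X q)) := by
  set v : TangentBundle 𝓘(ℝ, E) Q := ⟨q, X q⟩ with hv
  -- In the chart at `v` itself `tangentCoord` is the identity, so the chart formulas become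
  -- equalities of tangent vectors.
  have hs : v.proj ∈ (chartAt E v.proj).source := mem_chart_source E v.proj
  have h1 := tangentCoord_hlft nabla v v hs hX rfl (X q)
  have h2 := tangentCoord_section v v hs hX rfl (X q)
  have h3 := tangentCoord_vlft v v hs (nabla X q (X q))
  rw [tangentCoord_self] at h1 h2 h3
  refine h1.trans ?_
  refine Eq.trans ?_ (congrArg₂ (fun a b : E × E ↦ a - b) h2 h3).symm
  exact Prod.ext (sub_zero _).symm rfl

theorem geodesicSpray_mem_tangentSet {nabla : AffineConnection E Q}
    (hnabla : IsAnalyticConnection nabla) {𝒴 : Set ((q : Q) → TangentSpace 𝓘(ℝ, E) q)}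
    (h𝒴 : ∀ Y ∈ 𝒴, IsAnalyticVectorField Y) {v : TangentBundle 𝓘(ℝ, E) Q}
    (hrank : LocallyConstantRankAt (symDistrib nabla 𝒴) v.proj)
    (hv : v ∈ distribTotal (symDistrib nabla 𝒴)) :
    geodesicSpray nabla v ∈ tangentSet (distribTotal (symDistrib nabla 𝒴)) v := by
  obtain ⟨F, hF⟩ := exists_isZeroSetAt_symDistrib hnabla h𝒴 hrank hv
  obtain ⟨q, u⟩ := v
  obtain ⟨X, hX, hXu⟩ := id hv
  change X q = u at hXu
  subst hXu
  have hXd : MDifferentiableAt 𝓘(ℝ, E) 𝓘(ℝ, E).tangent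
      (fun q ↦ (⟨q, X q⟩ : TangentBundle 𝓘(ℝ, E) Q)) q :=
    (isAnalyticVectorField_of_mem_symClosure hnabla h𝒴 hX q).mdifferentiableAt (by simp)
  have h1 := IsZeroSetAt.mfderiv_mem_velocitySet
    (f := fun q ↦ (⟨q, X q⟩ : TangentBundle 𝓘(ℝ, E) Q)) (x := q) hF hXd
    (Filter.Eventually.of_forall fun p ↦ ⟨X, hX, rfl⟩) (X q)
  have h2 := vlft_mem_tangentSet (symDistrib nabla 𝒴) hv (nabla_self_mem_symDistrib hX q)
  have h3 := hF.add_mem_velocitySet h1 (hF.smul_mem_velocitySet (-1) h2)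
  have h4 := geodesicSpray_eq nabla hXd
  rw [tangentSet_eq_velocitySet]
  refine h4.symm ▸ ?_
  rw [sub_eq_add_neg, ← neg_one_smul ℝ]
  exact h3

/-- The smooth vector fields on `TQ` that are tangent to `Sym^(∞)(𝒴)` wherever its rank is locally
constant. -/
def tangentFields {nabla : AffineConnection E Q} (hnabla : IsAnalyticConnection nabla)
    {𝒴 : Set ((q : Q) → TangentSpace 𝓘(ℝ, E) q)} (h𝒴 : ∀ Y ∈ 𝒴, IsAnalyticVectorField Y) :
    Submodule ℝ ((v : TangentBundle 𝓘(ℝ, E) Q) → TangentSpace 𝓘(ℝ, E).tangent v) where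
  carrier := {W | ContMDiff 𝓘(ℝ, E).tangent 𝓘(ℝ, E).tangent.tangent ∞
      (fun v ↦ (⟨v, W v⟩ : TangentBundle 𝓘(ℝ, E).tangent (TangentBundle 𝓘(ℝ, E) Q))) ∧
    ∀ v ∈ distribTotal (symDistrib nabla 𝒴),
      LocallyConstantRankAt (symDistrib nabla 𝒴) v.proj →
        W v ∈ velocitySet 𝓘(ℝ, E).tangent (distribTotal (symDistrib nabla 𝒴)) v}
  add_mem' := fun hV hW ↦ ⟨ContMDiff.add_section hV.1 hW.1, fun v hv hr ↦
    have ⟨_, hF⟩ := exists_isZeroSetAt_symDistrib hnabla h𝒴 hr hv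
    hF.add_mem_velocitySet (hV.2 v hv hr) (hW.2 v hv hr)⟩
  zero_mem' := ⟨Bundle.contMDiff_zeroSection ℝ _, fun _ hv hr ↦
    have ⟨_, hF⟩ := exists_isZeroSetAt_symDistrib hnabla h𝒴 hr hv
    hF.zero_mem_velocitySet⟩
  smul_mem' := fun a _ hW ↦ ⟨ContMDiff.const_smul_section (a := a) hW.1, fun v hv hr ↦
    have ⟨_, hF⟩ := exists_isZeroSetAt_symDistrib hnabla h𝒴 hr hv
    hF.smul_mem_velocitySet a (hW.2 v hv hr)⟩

/-- The bracket at `v` uses tangency at nearby points of `D`. It is available because local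
constancy of the rank is an open condition and `tangentFields` asks for tangency at every such
point. -/
theorem mlieBracket_mem_tangentFields {nabla : AffineConnection E Q}
    (hnabla : IsAnalyticConnection nabla)
    {𝒴 : Set ((q : Q) → TangentSpace 𝓘(ℝ, E) q)} (h𝒴 : ∀ Y ∈ 𝒴, IsAnalyticVectorField Y)
    {V W : (v : TangentBundle 𝓘(ℝ, E) Q) → TangentSpace 𝓘(ℝ, E).tangent v}
    (hV : V ∈ tangentFields hnabla h𝒴) (hW : W ∈ tangentFields hnabla h𝒴) :
    VectorField.mlieBracket 𝓘(ℝ, E).tangent V W ∈ tangentFields hnabla h𝒴 := by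
  have : CompleteSpace E := FiniteDimensional.complete ℝ E
  refine ⟨?_, fun v hv hr ↦ ?_⟩
  · have : IsManifold 𝓘(ℝ, E).tangent ((⊤ : ℕ∞) + 1) (TangentBundle 𝓘(ℝ, E) Q) :=
      .of_le (n := ω) le_top
    -- A bracket costs one derivative, which the class `∞` absorbs.
    exact ContDiff.mlieBracket_vectorField (m := ⊤) (n := ⊤) hV.1 hW.1 (by simp)
  · obtain ⟨F, hF⟩ := exists_isZeroSetAt_symDistrib hnabla h𝒴 hr hv
    have hev : ∀ᶠ z : TangentBundle 𝓘(ℝ, E) Q in 𝓝 v,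
        LocallyConstantRankAt (symDistrib nabla 𝒴) z.proj :=
      (FiberBundle.continuous_proj E (TangentSpace 𝓘(ℝ, E))).continuousAt.eventually hr.eventually
    exact hF.mlieBracket_mem_velocitySet ((hV.1 v).mdifferentiableAt (by simp))
      ((hW.1 v).mdifferentiableAt (by simp)) hv
      (hev.mono fun z hz hzD ↦ hV.2 z hzD hz) (hev.mono fun z hz hzD ↦ hW.2 z hzD hz)

theorem lieClosure_le_tangentFields {nabla : AffineConnection E Q}
    (hnabla : IsAnalyticConnection nabla)
    {𝒴 : Set ((q : Q) → TangentSpace 𝓘(ℝ, E) q)} (h𝒴 : ∀ Y ∈ 𝒴, IsAnalyticVectorField Y) :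
    lieClosure (insert (geodesicSpray nabla) (verticalLift '' 𝒴)) ≤ tangentFields hnabla h𝒴 := by
  refine sInf_le ⟨?_, fun V hV W hW ↦ mlieBracket_mem_tangentFields hnabla h𝒴 hV hW⟩
  rintro W (rfl | ⟨Y, hY, rfl⟩)
  · exact ⟨(contMDiff_geodesicSpray hnabla).of_le le_top,
      fun v hv hr ↦ geodesicSpray_mem_tangentSet hnabla h𝒴 hr hv⟩
  · exact ⟨(contMDiff_verticalLift (h𝒴 Y hY)).of_le le_top,
      fun v hv _ ↦ vlft_mem_tangentSet _ hv ⟨Y, subset_symClosure nabla 𝒴 hY, rfl⟩⟩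

end Tangency

end ACCS

end

theorem mainTheorem5
    {E : Type*} [NormedAddCommGroup E] [NormedSpace ℝ E] [FiniteDimensional ℝ E]
    {Q : Type*} [TopologicalSpace Q] [T2Space Q] [ParacompactSpace Q]
    [ChartedSpace E Q] [IsManifold 𝓘(ℝ, E) ω Q]
    (nabla : ACCS.AffineConnection E Q) (hnabla : ACCS.IsAnalyticConnection nabla)
    {r : ℕ} (Y : Fin r → (q : Q) → TangentSpace 𝓘(ℝ, E) q)
    (hY : ∀ a, ACCS.IsAnalyticVectorField (Y a))
    (v : TangentBundle 𝓘(ℝ, E) Q)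
    (hrank : ACCS.LocallyConstantRankAt (ACCS.symDistrib nabla (Set.range Y)) v.proj)
    (hv : v ∈ ACCS.distribTotal (ACCS.symDistrib nabla (Set.range Y))) :
    (ACCS.accessDistrib nabla (Set.range Y) v : Set (TangentSpace 𝓘(ℝ, E).tangent v)) ⊆
      ACCS.tangentSet (ACCS.distribTotal (ACCS.symDistrib nabla (Set.range Y))) v := by
  rintro _ ⟨W, hW, rfl⟩
  have hY' : ∀ X ∈ Set.range Y, ACCS.IsAnalyticVectorField X := by
    rintro _ ⟨a, rfl⟩
    exact hY a
  exact (ACCS.lieClosure_le_tangentFields hnabla hY' hW).2 v hv hrank
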